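/- **Setting.** Let $N\ge 2$ players have actions $x_i\in\mathbb R^{n_i}$, let $n=\sum_i n_i\ge 1$, and let the costs be $J_i(x_i,x_{-i})$, $x=(x_1,\dots,x_N)\in\mathbb R^n$. A profile $x^*$ is a Nash equilibrium (NE) if $J_i(x_i^*,x_{-i}^*)\le J_i(y,x_{-i}^*)$ for all $i$ and all $y\in\mathbb R^{n_i}$. Let $\mathcal G$ be an undirected connected graph on the players with symmetric weights $a_{ij}>0$ on edges and $a_{ij}=0$ otherwise, and let $0=\lambda_1<\lambda_2\le\dots\le\lambda_N$ be the eigenvalues of its Laplacian. Assume: 1. for every $i$ and every fixed $x_{-i}$, $J_i(\cdot,x_{-i})$ is continuously differentiable, strictly convex and radially unbounded; 2. $F(x)=\mathrm{col}\{\nabla_iJ_i(x)\}_i$ satisfies $\langle F(x)-F(y),x-y\rangle\ge\mu\|x-y\|^2$ with $\mu>0$, and each $\nabla_iJ_i$ is Lipschitz in $x_i$ with constant $\theta_i$ (uniformly in $x_{-i}$) and Lipschitz in $x_{-i}$ with constant $\theta_{-i}$ (uniformly in $x_i$); put $\theta=\big(\sum_i(\theta_i^2+\theta_{-i}^2)\big)^{1/2}$;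 3. every NE $x^*$ satisfies $\|x^*\|_\infty\le M'$; initial states are restricted to $\|\boldsymbol x^i(0)\|_\infty\le M$ for all $i$; and $M_0=M+M'>0$. **Algorithm.** Player $i$ keeps an estimate $\boldsymbol x^i(t)\in\mathbb R^n$ of all actions. Let $q$ be the odd uniform quantizer with levels $-L,\dots,L$: $q(x)=0$ for $|x|<\frac12$, $q(x)=\min\{\lfloor x+\frac12\rfloor,L\}$ for $x\ge\frac12$, and $q(x)=-q(-x)$ for $x\le-\frac12$; let $Q$ be $q$ applied to each coordinate. With sampling period $T$ and scaling $s(k)$, the decoded values are $\widehat{\boldsymbol x}^j(0)=s(0)Q(\boldsymbol x^j(0)/s(0))$ and $\widehat{\boldsymbol x}^j(kT)=\widehat{\boldsymbol x}^j((k-1)T)+s(k)\,Q\big((\boldsymbol x^j(kT)-\widehat{\boldsymbol x}^j((k-1)T))/s(k)\big)$ for $k\ge1$, held constant on $[kT,(k+1)T)$. The estimates are continuous and follow $$\dot{\boldsymbol x}^i(t)=\alpha\sum_{j=1}^N a_{ij}\big(\widehat{\boldsymbol x}^j(t)-\widehat{\boldsymbol x}^i(t)\big)-R_i\nabla_iJ_i(\boldsymbol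 x^i(t)),\qquad t\ge0,\tag{D}$$ where $R_iv\in\mathbb R^n$ has $i$-th block $\varepsilon v$ and all other blocks $0$ (right derivative at the instants $kT$). **Parameters.** Put $$\nu=2\lambda_{\min}\begin{bmatrix}\mu/N&-\theta/\sqrt N\\-\theta/\sqrt N&\alpha\lambda_2/\varepsilon-\theta\end{bmatrix},\quad \gamma=\frac{\varepsilon\nu\beta}4,\quad \rho=\Big(\frac{\theta\varepsilon}{\alpha\lambda_N}+1\Big)\frac{8\alpha\lambda_N}{\nu^2\beta\varepsilon\sqrt{1-\beta}},$$ $$s(k)=\frac{\varepsilon\nu M_0}{\alpha\lambda_N}\sqrt{1-\beta}\;e^{-\gamma T-\alpha\lambda_NT}\,e^{-\gamma kT}.$$ Call $(\varepsilon,\alpha,\beta,a_1,a_2,T,L)$ *admissible* if $\varepsilon,T>0$, $\alpha>\frac{\varepsilon}{\lambda_2}\big(\frac{\theta^2}\mu+\theta\big)$, $\beta,a_1\in(0,1)$, $0<a_2<1-a_1$, the sampling condition $$(e^{\alpha\lambda_NT}-1)(e^{\gamma T}-1)\rho\,\varepsilon^{-1}\le a_1\tag{a1}$$ holds, and $L$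 is a positive integer with $L\ge\max\Big\{\frac{M_0}{s(0)},\Big\lceil\frac{\sqrt{Nn}\,e^{\gamma T+\alpha\lambda_NT}}{2a_2}-\frac12\Big\rceil\Big\}$. At each instant $kT$ every edge carries $n\log_2(2L+1)$ bits. The bandwidth is $\mathcal B=\max_{(j,i)\in\mathcal E}\limsup_{t\to\infty}\frac1t\sum_{k:\,t_k^{ji}\le t}r_{ji}(k)$, where $r_{ji}(k)$ is the number of bits sent at the sampling instant $t_k^{ji}=kT$. **Theorem.** The game has exactly one NE $x^*$. Say that (D) *converges exponentially to $x^*$ at rate $\gamma$* if $\gamma>0$ and there is a constant $C$ such that from every initial state with $\|\boldsymbol x^i(0)\|_\infty\le M$ for all $i$, (D) has a solution on $[0,\infty)$, and every solution satisfies $\|\boldsymbol x^i(t)-x^*\|\le Ce^{-\gamma t}$ for all $i$ and all $t\ge0$. Then: (i) for every $B>0$ there are admissible parameters for which the bandwidth is exactly $\mathcal B=B$ and (D) converges exponentially to $x^*$ at rate $\gamma$; (ii) for all $c>\frac1{\lambda_2}\big(\frac{\theta^2}\mu+\theta\big)$, $\beta,a_1\in(0,1)$ and $a_2\in(0,1-a_1)$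 there is an integer $L$ such that for every $T>0$ there is $\varepsilon_0>0$ such that for all $\varepsilon\in(0,\varepsilon_0)$ the parameters $(\varepsilon,c\varepsilon,\beta,a_1,a_2,T,L)$ are admissible (in particular (a1) holds), the bandwidth equals $n\log_2(2L+1)/T$, and (D) converges exponentially to $x^*$ at rate $\gamma$. -/

import Mathlib

open Set Filter Topology

namespace QNash

noncomputable section

/-! ### The game -/

/-- The action space `ℝ^{n_i}` of player `i`, with the Euclidean norm. -/
abbrev Action {N : ℕ} (n : Fin N → ℕ) (i : Fin N) : Type := EuclideanSpace ℝ (Fin (n i))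

/-- Action profiles `x = (x_1, …, x_N) ∈ ℝ^n`, `n = ∑ n_i`, with the Euclidean norm. -/
abbrev Profile {N : ℕ} (n : Fin N → ℕ) : Type := PiLp 2 (Action n)

variable {N : ℕ} {n : Fin N → ℕ}

/-- The profile `(y, x_{-i})`. -/
def replace (x : Profile n) (i : Fin N) (y : Action n i) : Profile n :=
  WithLp.toLp 2 (Function.update (fun j => x j) i y)

/-- Nash equilibrium of the game with cost functions `J i (x_i, x_{-i})`. -/
def IsNash (J : Fin N → Profile n → ℝ) (x : Profile n) : Prop :=
  ∀ i, ∀ y : Action n i, J i x ≤ J i (replace x i y)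

/-- The partial gradient `∇_i J_i (x_i, x_{-i})` with respect to player `i`'s own action. -/
def ownGrad (J : Fin N → Profile n → ℝ) (i : Fin N) (x : Profile n) : Action n i :=
  gradient (fun y => J i (replace x i y)) (x i)

/-- The game mapping `F(x) = col {∇_i J_i (x_i, x_{-i})}`. -/
def gameMap (J : Fin N → Profile n → ℝ) (x : Profile n) : Profile n :=
  WithLp.toLp 2 (fun i => ownGrad J i x)

/-- Each cost is, in the player's own action and for any fixed actions of the others,
continuously differentiable, strictly convex and radially unbounded. -/
structure CostAssumption (J : Fin N → Profile n → ℝ) : Prop where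
  contDiff : ∀ i x, ContDiff ℝ 1 (fun y => J i (replace x i y))
  strictConvex : ∀ i x, StrictConvexOn ℝ univ (fun y => J i (replace x i y))
  radiallyUnbounded : ∀ i x,
    Tendsto (fun y => J i (replace x i y)) (Bornology.cobounded (Action n i)) atTop

/-- Strong monotonicity of the game mapping, and Lipschitz continuity of each partial gradient
`∇_i J_i` in `x_i` (constant `θown i`) and in `x_{-i}` (constant `θoth i`). When `x_i = y_i`,
`‖x - y‖ = ‖x_{-i} - y_{-i}‖`. -/
structure MapAssumption (J : Fin N → Profile n → ℝ) (μ : ℝ) (θown θoth : Fin N → ℝ) : Prop where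
  mu_pos : 0 < μ
  own_nonneg : ∀ i, 0 ≤ θown i
  oth_nonneg : ∀ i, 0 ≤ θoth i
  stronglyMonotone : ∀ x y : Profile n,
    μ * ‖x - y‖ ^ 2 ≤ inner ℝ (gameMap J x - gameMap J y) (x - y)
  lipschitz_own : ∀ i (x y : Profile n), (∀ j, j ≠ i → x j = y j) →
    ‖ownGrad J i x - ownGrad J i y‖ ≤ θown i * ‖x i - y i‖
  lipschitz_oth : ∀ i (x y : Profile n), x i = y i →
    ‖ownGrad J i x - ownGrad J i y‖ ≤ θoth i * ‖x - y‖

/-- `‖x‖_∞ ≤ M` for a profile `x`. -/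
def SupBound (M : ℝ) (x : Profile n) : Prop := ∀ i c, |x i c| ≤ M

/-! ### The communication graph -/

/-- An undirected weighted graph on the players: `a_{ij} > 0` on edges, `a_{ij} = 0` otherwise. -/
structure WGraph (N : ℕ) where
  graph : SimpleGraph (Fin N)
  a : Matrix (Fin N) (Fin N) ℝ
  symm : ∀ i j, a i j = a j i
  pos : ∀ i j, graph.Adj i j → 0 < a i j
  zero : ∀ i j, ¬ graph.Adj i j → a i j = 0

/-- The Laplacian matrix: `l_{ij} = -a_{ij}` for `i ≠ j`, `l_{ii} = ∑_{j ≠ i} a_{ij}`. -/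
def WGraph.lap (G : WGraph N) : Matrix (Fin N) (Fin N) ℝ :=
  Matrix.of fun i j => if i = j then ∑ k ∈ Finset.univ.erase i, G.a i k else - G.a i j

theorem WGraph.lap_isHermitian (G : WGraph N) : G.lap.IsHermitian := by
  ext i j
  by_cases h : i = j
  · subst h; simp [WGraph.lap]
  · simp [WGraph.lap, h, Ne.symm h, G.symm i j]

/-- The eigenvalues of a symmetric matrix in ascending order, with multiplicity. -/
def sortedEig {m : ℕ} {A : Matrix (Fin m) (Fin m) ℝ} (hA : A.IsHermitian) (k : Fin m) : ℝ :=
  hA.eigenvalues₀ (Fin.cast (Fintype.card_fin m).symm k.rev)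

/-! ### The adaptive quantizer -/

/-- The scalar uniform quantizer with levels `-L, …, L`. -/
def quant (L : ℕ) (x : ℝ) : ℤ :=
  if -(1 / 2) < x ∧ x < 1 / 2 then 0
  else if 1 / 2 ≤ x then min ⌊x + 1 / 2⌋ (L : ℤ)
  else - min ⌊-x + 1 / 2⌋ (L : ℤ)

/-- A quantized message: one integer per coordinate. -/
abbrev Message {N : ℕ} (n : Fin N → ℕ) : Type := (i : Fin N) → Fin (n i) → ℤ

/-- The encoder: the coordinatewise quantization of `(v - prev) / s`. -/
def encode (L : ℕ) (s : ℝ) (v prev : Profile n) : Message n :=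
  fun i c => quant L ((v i c - prev i c) / s)

/-- A message read as a vector of `ℝ^n`. -/
def Message.toProfile (m : Message n) : Profile n :=
  WithLp.toLp 2 fun i => WithLp.toLp 2 fun c => (m i c : ℝ)

/-- The decoder output after sample `k`, for the samples `y 0, y 1, …` and the scaling `s`. -/
def decoded (L : ℕ) (s : ℕ → ℝ) (y : ℕ → Profile n) : ℕ → Profile n
  | 0 => s 0 • (encode L (s 0) (y 0) 0).toProfile
  | k + 1 => decoded L s y k + s (k + 1) •
      (encode L (s (k + 1)) (y (k + 1)) (decoded L s y k)).toProfile

/-! ### Design parameters -/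

/-- The constants of the problem: number `N` of players, total dimension `n`, monotonicity and
Lipschitz constants `μ, θ`, Laplacian eigenvalues `λ_2, λ_N`, and `M₀ = M + M'`. -/
structure Consts where
  N : ℕ
  n : ℕ
  μ : ℝ
  θ : ℝ
  lam2 : ℝ
  lamN : ℝ
  M₀ : ℝ

/-- `θ = (∑_i (θ_i² + θ_{-i}²))^{1/2}`, a Lipschitz constant of the game mapping and of the
augmented game mapping. -/
def lipConst (θown θoth : Fin N → ℝ) : ℝ := √(∑ i, (θown i ^ 2 + θoth i ^ 2))

/-- The constants attached to a game and a graph with at least two players. -/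
def consts (hN : 2 ≤ N) (n : Fin N → ℕ) (G : WGraph N) (μ : ℝ) (θown θoth : Fin N → ℝ)
    (M M' : ℝ) : Consts where
  N := N
  n := ∑ i, n i
  μ := μ
  θ := lipConst θown θoth
  lam2 := sortedEig G.lap_isHermitian ⟨1, by omega⟩
  lamN := sortedEig G.lap_isHermitian ⟨N - 1, by omega⟩
  M₀ := M + M'

/-- The tunable parameters of the algorithm. -/
structure Params where
  ε : ℝ
  α : ℝ
  β : ℝ
  a₁ : ℝ
  a₂ : ℝ
  T : ℝ
  L : ℕ

def nuMatrix (K : Consts) (p : Params) : Matrix (Fin 2) (Fin 2) ℝ :=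
  !![K.μ / K.N, -(K.θ / √K.N); -(K.θ / √K.N), p.α * K.lam2 / p.ε - K.θ]

theorem nuMatrix_isHermitian (K : Consts) (p : Params) : (nuMatrix K p).IsHermitian := by
  ext i j
  fin_cases i <;> fin_cases j <;> simp [nuMatrix]

/-- `ν = 2 λ_min` of the above matrix. -/
def nu (K : Consts) (p : Params) : ℝ := 2 * sortedEig (nuMatrix_isHermitian K p) 0

/-- The convergence rate `γ = ε ν β / 4`. -/
def rate (K : Consts) (p : Params) : ℝ := p.ε * nu K p * p.β / 4

def rho (K : Consts) (p : Params) : ℝ :=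
  (K.θ * p.ε / (p.α * K.lamN) + 1) *
    (8 * p.α * K.lamN / (nu K p ^ 2 * p.β * p.ε * √(1 - p.β)))

/-- The scaling function `s(k) = s(0) e^{-γ k T}`. -/
def scale (K : Consts) (p : Params) (k : ℕ) : ℝ :=
  p.ε * nu K p * K.M₀ / (p.α * K.lamN) * √(1 - p.β) *
    Real.exp (-rate K p * p.T - p.α * K.lamN * p.T) * Real.exp (-rate K p * k * p.T)

/-- The sampling condition `(e^{α λ_N T} - 1)(e^{γ T} - 1) ρ ε⁻¹ ≤ a₁`. -/
def SamplingCondition (K : Consts) (p : Params) : Prop :=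
  (Real.exp (p.α * K.lamN * p.T) - 1) * (Real.exp (rate K p * p.T) - 1) * rho K p * p.ε⁻¹ ≤ p.a₁

/-- The design rules for the parameters. -/
structure Admissible (K : Consts) (p : Params) : Prop where
  eps_pos : 0 < p.ε
  T_pos : 0 < p.T
  alpha_gt : p.ε / K.lam2 * (K.θ ^ 2 / K.μ + K.θ) < p.α
  beta_mem : p.β ∈ Ioo (0 : ℝ) 1
  a₁_mem : p.a₁ ∈ Ioo (0 : ℝ) 1
  a₂_mem : p.a₂ ∈ Ioo (0 : ℝ) (1 - p.a₁)
  sampling : SamplingCondition K p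
  L_pos : 0 < p.L
  L_ge_init : K.M₀ / scale K p 0 ≤ p.L
  L_ge : ⌈√((K.N : ℝ) * K.n) * Real.exp (p.ε * nu K p * p.β * p.T / 4 + p.α * K.lamN * p.T) /
      (2 * p.a₂) - 1 / 2⌉ ≤ (p.L : ℤ)

/-! ### The quantized dynamics -/

/-- The decoded value `x̂^j(kT)` along `x : ℝ → Fin N → Profile n`, where `x t j` is the vector of
player `j`'s estimates at time `t`. -/
def hat (K : Consts) (p : Params) (x : ℝ → Fin N → Profile n) (j : Fin N) (k : ℕ) : Profile n :=
  decoded p.L (scale K p) (fun l => x (l * p.T) j) k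

/-- `x` solves, for `t ≥ 0`,
`ẋ^i = α ∑_j a_{ij} (x̂^j(t) - x̂^i(t)) - R_i ∇_i J_i(x^i)`, where `x̂^j(t) = x̂^j(kT)` for
`kT ≤ t < (k+1)T` and `R_i` embeds `ε` times a vector of `ℝ^{n_i}` as the `i`-th block of `ℝ^n`.
Trajectories are continuous; at a sampling instant the derivative is the right derivative. -/
structure IsTrajectory (J : Fin N → Profile n → ℝ) (G : WGraph N) (K : Consts) (p : Params)
    (x : ℝ → Fin N → Profile n) : Prop where
  continuousOn : ∀ i, ContinuousOn (fun t => x t i) (Ici 0)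
  ode : ∀ i (k : ℕ), ∀ t ∈ Ico (k * p.T) ((k + 1) * p.T),
    HasDerivWithinAt (fun τ => x τ i)
      (p.α • ∑ j, G.a i j • (hat K p x j k - hat K p x i k)
        - (WithLp.toLp 2 (Pi.single i (p.ε • ownGrad J i (x t i))) : Profile n))
      (Ico (k * p.T) ((k + 1) * p.T)) t

/-- The dynamics converge exponentially to `xs`, at rate `γ`, from every initial state whose
entries are bounded by `M`: trajectories exist, and all of them converge. -/
def ExpConverges (J : Fin N → Profile n → ℝ) (G : WGraph N) (K : Consts) (p : Params) (M : ℝ)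
    (xs : Profile n) : Prop :=
  0 < rate K p ∧ ∃ C : ℝ, ∀ x₀ : Fin N → Profile n, (∀ i, SupBound M (x₀ i)) →
    (∃ x, IsTrajectory J G K p x ∧ x 0 = x₀) ∧
    ∀ x, IsTrajectory J G K p x → x 0 = x₀ →
      ∀ i t, 0 ≤ t → ‖x t i - xs‖ ≤ C * Real.exp (-rate K p * t)

/-! ### Bandwidth -/

/-- The bandwidth in bits per second when `r j i k` bits are sent over the edge `(j, i)` at the
instant `τ j i k`: the maximum over the edges of
`lim_{t → ∞} sup_{t' ≥ t} (1 / t') ∑_{τ_k ≤ t'} r(k)`. -/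
def bandwidth (G : WGraph N) (τ r : Fin N → Fin N → ℕ → ℝ) : EReal :=
  ⨆ (j : Fin N) (i : Fin N) (_ : G.graph.Adj j i),
    limsup (fun t' : ℝ => (((1 / t') * ∑ᶠ (k : ℕ) (_ : τ j i k ≤ t'), r j i k : ℝ) : EReal)) atTop

/-- Bits per sample: a message has `n` coordinates with `2L + 1` levels each. -/
def bitsPerSample (K : Consts) (L : ℕ) : ℝ := K.n * Real.logb 2 (2 * L + 1)

/-- The bandwidth used by the algorithm: one message per edge at each instant `kT`. -/
def algBandwidth (G : WGraph N) (K : Consts) (p : Params) : EReal :=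
  bandwidth G (fun _ _ k => k * p.T) (fun _ _ _ => bitsPerSample K p.L)

end

end QNash

/-! Stack all estimates into one state `X`, let `H` be the stack of decoded values, and write the
dynamics as Ẋ = -αℒX - ε·`embed (diagGrad J X)` - αℒ(H - X), with ℒ the Laplacian acting on the
player index. The last term is the only effect of quantization.

Without it the squared distance to the consensus state at x* contracts. Split `X` into its average
and its disagreement: ℒ controls the disagreement through λ₂ (`inner_lapState_ge`), strong
monotonicity of F controls the average, and Lipschitz bounds control the cross terms
(`inner_diagGrad_ge`). The resulting quadratic form is that of `nuMatrix`, so with u the distance,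
uu' ≤ -(εν/2)u² + αλ_N u‖H - X‖ (`inner_field_le`).

Put σ = εν/(αλ_N) and A = √(Nn)·M₀. If ‖H - X‖ ≤ η'Ae^{-γt} with η' = σ(1/2 - β/4), then αλ_N η' =
εν/2 - γ, and u ≤ Ae^{-γt} persists (`norm_sub_consensus_le`). Just after a sample, an unsaturated
quantizer leaves the smaller error ηAe^{-γkT}, with η = σ√(1 - β)/2. Since √(1 - β) < 1 - β/2, there
is a gap between η and η', and it pays for the drift of `X` up to the next sample. The drift is
bounded by Grönwall from data at the last sample only (`norm_drift_le`), so the state and error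
bounds are not circular. Induction over samples gives `expConverges_of_goodParams`.

If α = cε, then ν and σ do not depend on ε, while drift, e^{γT} - 1 and e^{αλ_N T} - 1 vanish as ε →
0. Hence `L` can be fixed before `T`, and small ε meets both the design rules and the requirements
of the induction (`exists_levels`). Since `T` is then free, every bandwidth is attained. The
equilibrium itself is the unique zero of F, found by a contraction argument. -/

namespace QNash

/-! ### Spectral calculus for real symmetric matrices -/

section Spectral

variable {m : ℕ} {A : Matrix (Fin m) (Fin m) ℝ}

theorem sortedEig_mono (hA : A.IsHermitian) : Monotone (sortedEig hA) := by
  intro i j hij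
  refine hA.eigenvalues₀_antitone ?_
  rw [Fin.le_def] at hij ⊢
  simp only [Fin.val_cast, Fin.val_rev]
  omega

theorem sortedEig_congr {B : Matrix (Fin m) (Fin m) ℝ} (hA : A.IsHermitian) (hB : B.IsHermitian)
    (h : A = B) : sortedEig hA = sortedEig hB := by
  subst h; rfl

/-- A symmetric matrix has an orthonormal basis of eigenvectors, listed by increasing
eigenvalue. -/
theorem exists_sorted_eigenbasis (hA : A.IsHermitian) :
    ∃ b : OrthonormalBasis (Fin m) ℝ (EuclideanSpace ℝ (Fin m)),
      ∀ k, Matrix.toEuclideanLin A (b k) = sortedEig hA k • b k := by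
  have hs := Matrix.isSymmetric_toEuclideanLin_iff.mpr hA
  refine ⟨(hs.eigenvectorBasis finrank_euclideanSpace).reindex
    ((finCongr (Fintype.card_fin m)).trans Fin.revPerm), fun k => ?_⟩
  rw [OrthonormalBasis.reindex_apply, hs.apply_eigenvectorBasis]
  rfl

variable {b : OrthonormalBasis (Fin m) ℝ (EuclideanSpace ℝ (Fin m))} {ev : Fin m → ℝ}

theorem eigenbasis_inner_apply (hA : A.IsHermitian)
    (hb : ∀ k, Matrix.toEuclideanLin A (b k) = ev k • b k)
    (v : EuclideanSpace ℝ (Fin m)) (k : Fin m) :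
    inner ℝ (b k) (Matrix.toEuclideanLin A v) = ev k * inner ℝ (b k) v := by
  have hs := Matrix.isSymmetric_toEuclideanLin_iff.mpr hA
  rw [← hs (b k) v, hb, real_inner_smul_left]

theorem inner_apply_eq_sum (hA : A.IsHermitian)
    (hb : ∀ k, Matrix.toEuclideanLin A (b k) = ev k • b k) (v : EuclideanSpace ℝ (Fin m)) :
    inner ℝ v (Matrix.toEuclideanLin A v) = ∑ k, ev k * (inner ℝ (b k) v) ^ 2 := by
  rw [← b.sum_inner_mul_inner]
  refine Finset.sum_congr rfl fun k _ => ?_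
  rw [eigenbasis_inner_apply hA hb, real_inner_comm]
  ring

theorem norm_sq_apply_eq_sum (hA : A.IsHermitian)
    (hb : ∀ k, Matrix.toEuclideanLin A (b k) = ev k • b k) (v : EuclideanSpace ℝ (Fin m)) :
    ‖Matrix.toEuclideanLin A v‖ ^ 2 = ∑ k, ev k ^ 2 * (inner ℝ (b k) v) ^ 2 := by
  rw [← b.sum_sq_inner_right]
  refine Finset.sum_congr rfl fun k _ => ?_
  rw [eigenbasis_inner_apply hA hb]
  ring

theorem toEuclideanLin_coord (A : Matrix (Fin m) (Fin m) ℝ) (v : EuclideanSpace ℝ (Fin m))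
    (i : Fin m) : Matrix.toEuclideanLin A v i = ∑ j, A i j * v j := by
  simp [Matrix.toLpLin_apply, Matrix.mulVec, dotProduct]

theorem inner_toEuclideanLin (A : Matrix (Fin m) (Fin m) ℝ) (v : EuclideanSpace ℝ (Fin m)) :
    inner ℝ v (Matrix.toEuclideanLin A v) = ∑ i, v i * ∑ j, A i j * v j := by
  rw [PiLp.inner_apply]
  refine Finset.sum_congr rfl fun i _ => ?_
  rw [toEuclideanLin_coord]
  simp [mul_comm]

theorem sortedEig_mul_norm_sq_le (hA : A.IsHermitian) {k : Fin m} (hk : ∀ j, k ≤ j)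
    (v : EuclideanSpace ℝ (Fin m)) :
    sortedEig hA k * ‖v‖ ^ 2 ≤ inner ℝ v (Matrix.toEuclideanLin A v) := by
  obtain ⟨b, hb⟩ := exists_sorted_eigenbasis hA
  rw [inner_apply_eq_sum hA hb, ← b.sum_sq_inner_right, Finset.mul_sum]
  exact Finset.sum_le_sum fun j _ =>
    mul_le_mul_of_nonneg_right (sortedEig_mono hA (hk j)) (sq_nonneg _)

theorem sortedEig_pos_of_inner_pos (hA : A.IsHermitian)
    (h : ∀ v : EuclideanSpace ℝ (Fin m), v ≠ 0 → 0 < inner ℝ v (Matrix.toEuclideanLin A v))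
    (k : Fin m) : 0 < sortedEig hA k := by
  obtain ⟨b, hb⟩ := exists_sorted_eigenbasis hA
  have := h (b k) (b.orthonormal.ne_zero k)
  rwa [hb, real_inner_smul_right, real_inner_self_eq_norm_sq, b.norm_eq_one, one_pow,
    mul_one] at this

end Spectral

/-! ### Spectrum of the graph Laplacian -/

section Laplacian

variable {N : ℕ} (G : WGraph N)

theorem WGraph.a_self (i : Fin N) : G.a i i = 0 := G.zero i i (G.graph.irrefl)

theorem WGraph.a_nonneg (i j : Fin N) : 0 ≤ G.a i j := by
  by_cases h : G.graph.Adj i j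
  · exact (G.pos i j h).le
  · exact (G.zero i j h).ge

theorem WGraph.lap_mul (v : Fin N → ℝ) (i : Fin N) :
    ∑ j, G.lap i j * v j = ∑ j, G.a i j * (v i - v j) := by
  have h1 : ∀ j, G.lap i j * v j
      = (if i = j then (∑ k, G.a i k) * v i else 0) - G.a i j * v j := by
    intro j
    by_cases h : i = j
    · subst h
      simp [WGraph.lap, G.a_self]
    · simp [WGraph.lap, h]
  simp_rw [h1, Finset.sum_sub_distrib, mul_sub, Finset.sum_sub_distrib]
  simp [Finset.sum_mul]

/-- Symmetry of the weights lets i and j be exchanged; averaging the two forms produces the square.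
-/
theorem WGraph.lap_quadratic (v : Fin N → ℝ) :
    ∑ i, v i * ∑ j, G.a i j * (v i - v j) = 1 / 2 * ∑ i, ∑ j, G.a i j * (v i - v j) ^ 2 := by
  have h1 : ∑ i, v i * ∑ j, G.a i j * (v i - v j)
      = ∑ i, ∑ j, G.a i j * (v i * (v i - v j)) := by
    simp_rw [Finset.mul_sum]
    exact Finset.sum_congr rfl fun i _ => Finset.sum_congr rfl fun j _ => by ring
  have h2 : ∑ i, ∑ j, G.a i j * (v i * (v i - v j))
      = ∑ i, ∑ j, G.a i j * (v j * (v j - v i)) := by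
    rw [Finset.sum_comm]
    exact Finset.sum_congr rfl fun i _ => Finset.sum_congr rfl fun j _ => by rw [G.symm]
  have h3 : ∑ i, ∑ j, G.a i j * (v i - v j) ^ 2
      = ∑ i, ∑ j, G.a i j * (v i * (v i - v j)) + ∑ i, ∑ j, G.a i j * (v j * (v j - v i)) := by
    simp_rw [← Finset.sum_add_distrib]
    exact Finset.sum_congr rfl fun i _ => Finset.sum_congr rfl fun j _ => by ring
  rw [h1, h3, ← h2]
  ring

theorem WGraph.inner_lap_nonneg (v : EuclideanSpace ℝ (Fin N)) :
    0 ≤ inner ℝ v (Matrix.toEuclideanLin G.lap v) := by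
  rw [inner_toEuclideanLin]
  simp_rw [G.lap_mul]
  rw [G.lap_quadratic]
  exact mul_nonneg (by norm_num) (Finset.sum_nonneg fun i _ => Finset.sum_nonneg fun j _ =>
    mul_nonneg (G.a_nonneg i j) (sq_nonneg _))

/-- Zero energy forces equality across every edge, and a walk carries the equality between any two
vertices. -/
theorem WGraph.eq_of_inner_lap_eq_zero {G : WGraph N} (hG : G.graph.Connected)
    {v : EuclideanSpace ℝ (Fin N)} (h : inner ℝ v (Matrix.toEuclideanLin G.lap v) = 0)
    (i j : Fin N) : v i = v j := by
  rw [inner_toEuclideanLin] at h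
  simp_rw [G.lap_mul] at h
  rw [G.lap_quadratic] at h
  have hnn : ∀ i j, 0 ≤ G.a i j * (v i - v j) ^ 2 := fun i j =>
    mul_nonneg (G.a_nonneg i j) (sq_nonneg _)
  have h0 : ∑ i, ∑ j, G.a i j * (v i - v j) ^ 2 = 0 := by linarith
  have hz : ∀ i j, G.a i j * (v i - v j) ^ 2 = 0 := by
    intro i j
    have h1 := (Finset.sum_eq_zero_iff_of_nonneg
      (fun i _ => Finset.sum_nonneg fun j _ => hnn i j)).1 h0 i (Finset.mem_univ i)
    exact (Finset.sum_eq_zero_iff_of_nonneg (fun j _ => hnn i j)).1 h1 j (Finset.mem_univ j)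
  have hadj : ∀ i j, G.graph.Adj i j → v i = v j := by
    intro i j hij
    have := (mul_eq_zero.1 (hz i j)).resolve_left (G.pos i j hij).ne'
    exact sub_eq_zero.1 (pow_eq_zero_iff (two_ne_zero) |>.1 this)
  obtain ⟨w⟩ := hG.preconnected i j
  induction w with
  | nil => rfl
  | cons hij _ ih => exact (hadj _ _ hij).trans ih

theorem WGraph.sortedEig_nonneg (k : Fin N) : 0 ≤ sortedEig G.lap_isHermitian k := by
  obtain ⟨b, hb⟩ := exists_sorted_eigenbasis G.lap_isHermitian
  have := G.inner_lap_nonneg (b k)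
  rwa [hb, real_inner_smul_right, real_inner_self_eq_norm_sq, b.norm_eq_one, one_pow,
    mul_one] at this

/-- Two vectors in the kernel of the Laplacian of a connected graph are not orthogonal, so the
algebraic connectivity is positive. -/
theorem WGraph.lam2_pos {G : WGraph N} (hN : 2 ≤ N) (hG : G.graph.Connected) :
    0 < sortedEig G.lap_isHermitian ⟨1, by omega⟩ := by
  obtain ⟨b, hb⟩ := exists_sorted_eigenbasis G.lap_isHermitian
  by_contra hneg
  have h1 : sortedEig G.lap_isHermitian ⟨1, by omega⟩ = 0 :=
    le_antisymm (not_lt.1 hneg) (G.sortedEig_nonneg _)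
  have h0 : sortedEig G.lap_isHermitian ⟨0, by omega⟩ = 0 :=
    le_antisymm (h1 ▸ sortedEig_mono G.lap_isHermitian (by simp)) (G.sortedEig_nonneg _)
  have hc : ∀ k, sortedEig G.lap_isHermitian k = 0 → ∀ i, b k i = b k ⟨0, by omega⟩ := by
    intro k hk i
    refine WGraph.eq_of_inner_lap_eq_zero hG ?_ i _
    rw [hb, hk, zero_smul, inner_zero_right]
  have hin : inner ℝ (b ⟨0, by omega⟩) (b ⟨1, by omega⟩) = (0 : ℝ) :=
    b.orthonormal.inner_eq_zero (by simp)
  rw [PiLp.inner_apply] at hin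
  simp_rw [hc _ h1, hc _ h0] at hin
  simp only [Finset.sum_const, Finset.card_univ, Fintype.card_fin, nsmul_eq_mul] at hin
  have hN0 : (N : ℝ) ≠ 0 := by positivity
  have hne : ∀ k, sortedEig G.lap_isHermitian k = 0 → b k ⟨0, by omega⟩ ≠ 0 := by
    intro k hk h
    refine b.orthonormal.ne_zero k ?_
    ext i
    rw [hc k hk, h]; rfl
  have h3 := (mul_eq_zero.1 hin).resolve_left hN0
  simp only [RCLike.inner_apply, conj_trivial, mul_eq_zero] at h3
  exact h3.elim (hne _ h1) (hne _ h0)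

theorem WGraph.norm_lap_le (hN : 2 ≤ N) (v : Fin N → ℝ) :
    ∑ i, (∑ j, G.a i j * (v i - v j)) ^ 2
      ≤ sortedEig G.lap_isHermitian ⟨N - 1, by omega⟩ ^ 2 * ∑ i, v i ^ 2 := by
  obtain ⟨b, hb⟩ := exists_sorted_eigenbasis G.lap_isHermitian
  set w : EuclideanSpace ℝ (Fin N) := WithLp.toLp 2 v
  have h1 : ∑ i, (∑ j, G.a i j * (v i - v j)) ^ 2 = ‖Matrix.toEuclideanLin G.lap w‖ ^ 2 := by
    rw [EuclideanSpace.real_norm_sq_eq]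
    simp_rw [toEuclideanLin_coord, G.lap_mul]
    rfl
  have h2 : ∑ i, v i ^ 2 = ‖w‖ ^ 2 := by rw [EuclideanSpace.real_norm_sq_eq]
  rw [h1, h2, norm_sq_apply_eq_sum G.lap_isHermitian hb, ← b.sum_sq_inner_right, Finset.mul_sum]
  refine Finset.sum_le_sum fun k _ => mul_le_mul_of_nonneg_right ?_ (sq_nonneg _)
  refine pow_le_pow_left₀ (G.sortedEig_nonneg k) (sortedEig_mono _ ?_) 2
  rw [Fin.le_def]
  have := k.2
  simp only
  omega

/-- On vectors orthogonal to the constants the Laplacian is bounded below by the algebraic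
connectivity. -/
theorem WGraph.lam2_mul_le {G : WGraph N} (hN : 2 ≤ N) (hG : G.graph.Connected) (v : Fin N → ℝ)
    (hv : ∑ i, v i = 0) :
    sortedEig G.lap_isHermitian ⟨1, by omega⟩ * ∑ i, v i ^ 2
      ≤ ∑ i, v i * ∑ j, G.a i j * (v i - v j) := by
  obtain ⟨b, hb⟩ := exists_sorted_eigenbasis G.lap_isHermitian
  set w : EuclideanSpace ℝ (Fin N) := WithLp.toLp 2 v with hw
  have h1 : ∑ i, v i * ∑ j, G.a i j * (v i - v j)
      = inner ℝ w (Matrix.toEuclideanLin G.lap w) := by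
    rw [inner_toEuclideanLin]
    simp_rw [G.lap_mul]
    rfl
  have h2 : ∑ i, v i ^ 2 = ‖w‖ ^ 2 := by rw [EuclideanSpace.real_norm_sq_eq]
  rw [h1, h2, inner_apply_eq_sum G.lap_isHermitian hb, ← b.sum_sq_inner_right, Finset.mul_sum]
  refine Finset.sum_le_sum fun k _ => ?_
  by_cases hk : 1 ≤ k.1
  · exact mul_le_mul_of_nonneg_right (sortedEig_mono _ (Fin.le_def.2 hk)) (sq_nonneg _)
  -- Only the bottom index remains. Testing with the constant vector shows its eigenvalue is 0, so
  -- its eigenvector is constant and orthogonal to `w`; that term of the sum vanishes.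
  have hk0 : sortedEig G.lap_isHermitian k = 0 := by
    set one : EuclideanSpace ℝ (Fin N) := WithLp.toLp 2 fun _ => 1 with hone
    have hq := sortedEig_mul_norm_sq_le G.lap_isHermitian (k := k)
      (fun j => by rw [Fin.le_def]; omega) one
    have hz : inner ℝ one (Matrix.toEuclideanLin G.lap one) = 0 := by
      rw [inner_toEuclideanLin]
      simp_rw [G.lap_mul]
      simp [hone]
    have hpos : 0 < ‖one‖ ^ 2 := by
      rw [EuclideanSpace.real_norm_sq_eq]
      simp [hone]
      omega
    rw [hz] at hq
    exact le_antisymm (nonpos_of_mul_nonpos_left hq hpos) (G.sortedEig_nonneg k)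
  have hconst : ∀ i, b k i = b k ⟨0, by omega⟩ := fun i =>
    WGraph.eq_of_inner_lap_eq_zero hG (by rw [hb, hk0, zero_smul, inner_zero_right]) i _
  have hin : inner ℝ (b k) w = 0 := by
    rw [PiLp.inner_apply]
    simp_rw [hconst]
    simp [hw, ← Finset.sum_mul, hv]
  simp [hin]

end Laplacian

/-! ### Critical points of convex functions -/

section Convex

/-- A critical point of a convex function is a global minimum. -/
theorem le_of_fderiv_eq_zero_of_convexOn {E : Type*} [NormedAddCommGroup E] [NormedSpace ℝ E]
    {f : E → ℝ} (hf : ConvexOn ℝ univ f) {x : E} (hd : DifferentiableAt ℝ f x)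
    (h0 : fderiv ℝ f x = 0) (y : E) : f x ≤ f y := by
  set l : ℝ → E := ⇑(AffineMap.lineMap x y : ℝ →ᵃ[ℝ] E) with hl
  have hconv : ConvexOn ℝ univ (f ∘ l) := by
    simpa using hf.comp_affineMap (AffineMap.lineMap x y : ℝ →ᵃ[ℝ] E)
  have hl0 : l 0 = x := AffineMap.lineMap_apply_zero x y
  have hl1 : l 1 = y := AffineMap.lineMap_apply_one x y
  have hderiv : HasDerivAt (f ∘ l) 0 0 := by
    have h1 : HasFDerivAt f (0 : E →L[ℝ] ℝ) (l 0) := by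
      rw [hl0, ← h0]; exact hd.hasFDerivAt
    simpa using h1.comp_hasDerivAt (0 : ℝ) (AffineMap.hasDerivAt_lineMap (a := x) (b := y))
  have := hconv.le_slope_of_hasDerivAt (mem_univ 0) (mem_univ 1) one_pos hderiv
  simpa [slope_def_field, hl0, hl1] using this

end Convex

/-! ### The game mapping and its unique zero -/

section Game

variable {N : ℕ} {n : Fin N → ℕ} {J : Fin N → Profile n → ℝ} {μ : ℝ} {θown θoth : Fin N → ℝ}

theorem replace_apply_self (x : Profile n) (i : Fin N) (y : Action n i) : replace x i y i = y := by
  simp [replace]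

theorem replace_apply_of_ne (x : Profile n) {i j : Fin N} (h : j ≠ i) (y : Action n i) :
    replace x i y j = x j := by
  simp [replace, h]

theorem replace_self (x : Profile n) (i : Fin N) : replace x i (x i) = x := by
  simp [replace]

theorem ownGrad_eq_zero_iff (i : Fin N) (x : Profile n) :
    ownGrad J i x = 0 ↔ fderiv ℝ (fun y => J i (replace x i y)) (x i) = 0 := by
  simp [ownGrad, gradient]

/-- Nash equilibria are the zeros of the game mapping. -/
theorem isNash_iff_gameMap_eq_zero (hJ : CostAssumption J) (x : Profile n) :
    IsNash J x ↔ gameMap J x = 0 := by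
  have hz : gameMap J x = 0 ↔ ∀ i, ownGrad J i x = 0 := by
    constructor
    · intro h i
      exact congrArg (fun z : Profile n => z i) h
    · intro h
      ext1 i
      exact h i
  rw [hz]
  refine forall_congr' fun i => ?_
  rw [ownGrad_eq_zero_iff]
  constructor
  · intro h
    refine IsLocalMin.fderiv_eq_zero (Filter.Eventually.of_forall fun y => ?_)
    simpa [replace_self] using h y
  · intro h y
    have := le_of_fderiv_eq_zero_of_convexOn (hJ.strictConvex i x).convexOn
      ((hJ.contDiff i x).differentiable one_ne_zero _) h y
    simpa [replace_self] using this

/-- Pass through the point `z` that changes block `i` only. The two displacements are orthogonal, so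
Cauchy–Schwarz combines the two Lipschitz constants into a sum of squares. -/
theorem ownGrad_lipschitz (hF : MapAssumption J μ θown θoth) (i : Fin N) (x y : Profile n) :
    ‖ownGrad J i x - ownGrad J i y‖ ^ 2 ≤ (θown i ^ 2 + θoth i ^ 2) * ‖x - y‖ ^ 2 := by
  set z := replace x i (y i) with hz
  have h1 : ‖ownGrad J i x - ownGrad J i z‖ ≤ θown i * ‖x i - y i‖ := by
    have := hF.lipschitz_own i x z fun j hj => (replace_apply_of_ne x hj _).symm
    rwa [hz, replace_apply_self] at this
  have h2 : ‖ownGrad J i z - ownGrad J i y‖ ≤ θoth i * ‖z - y‖ :=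
    hF.lipschitz_oth i z y (replace_apply_self x i _)
  have h3 : ‖x - y‖ ^ 2 = ‖x i - y i‖ ^ 2 + ‖z - y‖ ^ 2 := by
    rw [PiLp.norm_sq_eq_of_L2 _ (x - y), PiLp.norm_sq_eq_of_L2 _ (z - y),
      ← Finset.add_sum_erase _ _ (Finset.mem_univ i),
      ← Finset.add_sum_erase (Finset.univ) (fun j => ‖(z - y) j‖ ^ 2) (Finset.mem_univ i)]
    have e1 : (z - y) i = 0 := by
      rw [PiLp.sub_apply, hz, replace_apply_self, sub_self]
    have e2 : ∑ j ∈ Finset.univ.erase i, ‖(x - y) j‖ ^ 2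
        = ∑ j ∈ Finset.univ.erase i, ‖(z - y) j‖ ^ 2 := by
      refine Finset.sum_congr rfl fun j hj => ?_
      rw [PiLp.sub_apply, PiLp.sub_apply, hz, replace_apply_of_ne x (Finset.ne_of_mem_erase hj)]
    rw [e1, e2, PiLp.sub_apply]
    simp
  have h4 : ‖ownGrad J i x - ownGrad J i y‖ ≤ θown i * ‖x i - y i‖ + θoth i * ‖z - y‖ :=
    (norm_sub_le_norm_sub_add_norm_sub _ (ownGrad J i z) _).trans (add_le_add h1 h2)
  calc ‖ownGrad J i x - ownGrad J i y‖ ^ 2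
      ≤ (θown i * ‖x i - y i‖ + θoth i * ‖z - y‖) ^ 2 := by gcongr
    _ ≤ (θown i ^ 2 + θoth i ^ 2) * (‖x i - y i‖ ^ 2 + ‖z - y‖ ^ 2) := by
        nlinarith [sq_nonneg (θown i * ‖z - y‖ - θoth i * ‖x i - y i‖)]
    _ = _ := by rw [h3]

theorem lipConst_sq (θown θoth : Fin N → ℝ) :
    lipConst θown θoth ^ 2 = ∑ i, (θown i ^ 2 + θoth i ^ 2) :=
  Real.sq_sqrt (Finset.sum_nonneg fun _ _ => by positivity)

theorem lipConst_nonneg (θown θoth : Fin N → ℝ) : 0 ≤ lipConst θown θoth := Real.sqrt_nonneg _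

/-- The joint state of the players' estimates, with the Euclidean norm. -/
abbrev State {N : ℕ} (n : Fin N → ℕ) : Type := PiLp 2 fun _ : Fin N => Profile n

/-- The state in which all the players' estimates agree. -/
noncomputable def consensus (x : Profile n) : State n := WithLp.toLp 2 fun _ => x

/-- The estimates that the players have of their own actions. -/
noncomputable def diag (X : State n) : Profile n := WithLp.toLp 2 fun i => X i i

/-- The partial gradients, each evaluated at the player's own estimate. -/
noncomputable def diagGrad (J : Fin N → Profile n → ℝ) (X : State n) : Profile n :=
  WithLp.toLp 2 fun i => ownGrad J i (X i)

/-- The embedding of profiles in states that is adjoint to `diag`. -/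
noncomputable def embed (u : Profile n) : State n :=
  WithLp.toLp 2 fun i => WithLp.toLp 2 (Pi.single i (u i))

theorem diagGrad_consensus (x : Profile n) : diagGrad J (consensus x) = gameMap J x := rfl

theorem diag_consensus (x : Profile n) : diag (consensus x) = x := rfl

theorem norm_diag_le (X : State n) : ‖diag X‖ ≤ ‖X‖ := by
  refine abs_le_of_sq_le_sq' ?_ (norm_nonneg _) |>.2
  rw [PiLp.norm_sq_eq_of_L2, PiLp.norm_sq_eq_of_L2]
  exact Finset.sum_le_sum fun i _ =>
    pow_le_pow_left₀ (norm_nonneg _) (PiLp.norm_apply_le (X i) i) 2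

theorem norm_embed (u : Profile n) : ‖embed u‖ = ‖u‖ := by
  refine (pow_left_inj₀ (norm_nonneg _) (norm_nonneg _) two_ne_zero).1 ?_
  rw [PiLp.norm_sq_eq_of_L2, PiLp.norm_sq_eq_of_L2]
  refine Finset.sum_congr rfl fun i _ => ?_
  simp [embed]

theorem inner_embed (X : State n) (u : Profile n) : inner ℝ X (embed u) = inner ℝ (diag X) u := by
  rw [PiLp.inner_apply, PiLp.inner_apply]
  refine Finset.sum_congr rfl fun i _ => ?_
  rw [PiLp.inner_apply, Finset.sum_eq_single i]
  · simp [embed, diag]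
  · intro j _ hj
    simp [embed, hj]
  · simp

theorem embed_sub (u v : Profile n) : embed (u - v) = embed u - embed v := by
  ext i j c
  by_cases h : j = i
  · subst h; simp [embed]
  · simp [embed, h]

theorem norm_consensus_sq (x : Profile n) : ‖consensus x‖ ^ 2 = N * ‖x‖ ^ 2 := by
  rw [PiLp.norm_sq_eq_of_L2]
  simp [consensus]

theorem diagGrad_lipschitz (hF : MapAssumption J μ θown θoth) (X Y : State n) :
    ‖diagGrad J X - diagGrad J Y‖ ≤ lipConst θown θoth * ‖X - Y‖ := by
  refine abs_le_of_sq_le_sq' ?_ (mul_nonneg (lipConst_nonneg _ _) (norm_nonneg _)) |>.2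
  rw [mul_pow, lipConst_sq, PiLp.norm_sq_eq_of_L2, Finset.sum_mul]
  refine Finset.sum_le_sum fun i _ => (ownGrad_lipschitz hF i (X i) (Y i)).trans ?_
  gcongr
  exact PiLp.norm_apply_le (X - Y) i

theorem gameMap_lipschitz (hF : MapAssumption J μ θown θoth) (x y : Profile n) :
    ‖gameMap J x - gameMap J y‖ ≤ lipConst θown θoth * ‖x - y‖ := by
  refine abs_le_of_sq_le_sq' ?_ (mul_nonneg (lipConst_nonneg _ _) (norm_nonneg _)) |>.2
  rw [mul_pow, lipConst_sq, PiLp.norm_sq_eq_of_L2, Finset.sum_mul]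
  exact Finset.sum_le_sum fun i _ => ownGrad_lipschitz hF i x y

theorem exists_coordinate (hn : 0 < ∑ i, n i) : ∃ i, ∃ _ : Fin (n i), True := by
  obtain ⟨i, _, hi⟩ := Finset.exists_ne_zero_of_sum_ne_zero hn.ne'
  exact ⟨i, ⟨0, Nat.pos_of_ne_zero hi⟩, trivial⟩

/-- Compare strong monotonicity with the Lipschitz bound along a unit vector, which exists because n
≥ 1. -/
theorem mu_le_lipConst (hn : 0 < ∑ i, n i) (hF : MapAssumption J μ θown θoth) :
    μ ≤ lipConst θown θoth := by
  obtain ⟨i, c, -⟩ := exists_coordinate hn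
  set x : Profile n := WithLp.toLp 2 (Pi.single i (EuclideanSpace.single c (1 : ℝ))) with hx
  have hx1 : ‖x‖ = 1 := by simp [hx]
  have h1 := hF.stronglyMonotone x 0
  have h2 := gameMap_lipschitz hF x 0
  have h3 := real_inner_le_norm (gameMap J x - gameMap J 0) (x - 0)
  rw [sub_zero, hx1] at *
  linarith

theorem lipConst_pos (hn : 0 < ∑ i, n i) (hF : MapAssumption J μ θown θoth) :
    0 < lipConst θown θoth := hF.mu_pos.trans_le (mu_le_lipConst hn hF)

/-- A strongly monotone Lipschitz mapping has a zero. -/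
theorem exists_gameMap_eq_zero (hn : 0 < ∑ i, n i) (hF : MapAssumption J μ θown θoth) :
    ∃ x, gameMap J x = 0 := by
  have hμ := hF.mu_pos
  have hμθ := mu_le_lipConst hn hF
  set θ := lipConst θown θoth with hθ
  have hθ0 : 0 < θ := hμ.trans_le hμθ
  -- This step size minimises 1 - 2τμ + τ²θ², the squared contraction factor of x ↦ x - τF(x); the
  -- minimum is 1 - μ²/θ², nonnegative because μ ≤ θ.
  set τ := μ / θ ^ 2 with hτ
  set q := √(1 - μ ^ 2 / θ ^ 2) with hq
  have hq1 : q < 1 := by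
    rw [hq, Real.sqrt_lt' one_pos]
    have : 0 < μ ^ 2 / θ ^ 2 := by positivity
    linarith
  have hq2 : q ^ 2 = 1 - μ ^ 2 / θ ^ 2 := by
    refine Real.sq_sqrt ?_
    rw [sub_nonneg, div_le_one (by positivity)]
    gcongr
  have hlip : LipschitzWith q.toNNReal fun x => x - τ • gameMap J x := by
    refine LipschitzWith.of_dist_le_mul fun x y => ?_
    rw [Real.coe_toNNReal _ (Real.sqrt_nonneg _), dist_eq_norm, dist_eq_norm]
    refine abs_le_of_sq_le_sq' ?_ (by positivity) |>.2
    have e : x - τ • gameMap J x - (y - τ • gameMap J y)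
        = (x - y) - τ • (gameMap J x - gameMap J y) := by
      rw [smul_sub]; abel
    rw [e, norm_sub_sq_real, real_inner_smul_right, real_inner_comm, norm_smul, mul_pow, mul_pow,
      hq2, Real.norm_eq_abs, sq_abs]
    have h1 := hF.stronglyMonotone x y
    have h2 : ‖gameMap J x - gameMap J y‖ ^ 2 ≤ (θ * ‖x - y‖) ^ 2 := by
      gcongr
      exact gameMap_lipschitz hF x y
    have hτ0 : 0 < τ := by positivity
    have h3 := mul_le_mul_of_nonneg_left h1 hτ0.le
    have h4 := mul_le_mul_of_nonneg_left h2 (sq_nonneg τ)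
    have h5 : τ * μ = μ ^ 2 / θ ^ 2 := by rw [hτ]; ring
    have h6 : τ ^ 2 * θ ^ 2 = μ ^ 2 / θ ^ 2 := by rw [hτ]; field_simp
    have h7 : τ ^ 2 * (θ * ‖x - y‖) ^ 2 = μ ^ 2 / θ ^ 2 * ‖x - y‖ ^ 2 := by rw [← h6]; ring
    have h8 : τ * (μ * ‖x - y‖ ^ 2) = μ ^ 2 / θ ^ 2 * ‖x - y‖ ^ 2 := by rw [← h5]; ring
    rw [h7] at h4
    rw [h8] at h3
    linarith
  have hc : ContractingWith q.toNNReal fun x => x - τ • gameMap J x :=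
    ⟨by simpa using hq1, hlip⟩
  refine ⟨ContractingWith.fixedPoint _ hc, ?_⟩
  have hfix : ContractingWith.fixedPoint _ hc - τ • gameMap J (ContractingWith.fixedPoint _ hc)
      = ContractingWith.fixedPoint _ hc := hc.fixedPoint_isFixedPt
  rw [sub_eq_self, smul_eq_zero] at hfix
  exact hfix.resolve_left (by positivity)

theorem eq_of_gameMap_eq_zero (hF : MapAssumption J μ θown θoth) {x y : Profile n}
    (hx : gameMap J x = 0) (hy : gameMap J y = 0) : x = y := by
  have h := hF.stronglyMonotone x y
  rw [hx, hy, sub_zero, inner_zero_left] at h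
  have h2 : ‖x - y‖ ^ 2 ≤ 0 := nonpos_of_mul_nonpos_right h hF.mu_pos
  exact sub_eq_zero.1 (norm_eq_zero.1 (pow_eq_zero_iff two_ne_zero |>.1
    (le_antisymm h2 (sq_nonneg _))))

end Game

/-! ### The Laplacian on states; consensus and disagreement -/

section LapState

variable {N : ℕ} {n : Fin N → ℕ}

/-- The Laplacian acting on states. -/
noncomputable def lapState (G : WGraph N) (X : State n) : State n :=
  WithLp.toLp 2 fun i => ∑ j, G.a i j • (X i - X j)

theorem lapState_coord (G : WGraph N) (X : State n) (i k : Fin N) (c : Fin (n k)) :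
    lapState G X i k c = ∑ j, G.a i j * (X i k c - X j k c) := by
  simp [lapState]

theorem lapState_sub (G : WGraph N) (X Y : State n) :
    lapState G (X - Y) = lapState G X - lapState G Y := by
  ext i k c
  simp only [PiLp.sub_apply, lapState_coord, ← Finset.sum_sub_distrib]
  exact Finset.sum_congr rfl fun j _ => by ring

theorem lapState_consensus (G : WGraph N) (x : Profile n) : lapState G (consensus x) = 0 := by
  ext i k c
  simp [lapState, consensus]

theorem state_norm_sq (X : State n) : ‖X‖ ^ 2 = ∑ k, ∑ c, ∑ i, X i k c ^ 2 := by
  simp_rw [PiLp.norm_sq_eq_of_L2, Real.norm_eq_abs, sq_abs]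
  rw [Finset.sum_comm]
  exact Finset.sum_congr rfl fun k _ => Finset.sum_comm

theorem state_inner (X Y : State n) : inner ℝ X Y = ∑ k, ∑ c, ∑ i, X i k c * Y i k c := by
  simp_rw [PiLp.inner_apply]
  rw [Finset.sum_comm]
  refine Finset.sum_congr rfl fun k _ => ?_
  rw [Finset.sum_comm]
  exact Finset.sum_congr rfl fun c _ => Finset.sum_congr rfl fun i _ => by simp [mul_comm]

/-- The operator acts separately on each of the n coordinates, so the scalar bound applies to each
slice of `N` numbers. -/
theorem norm_lapState_le (G : WGraph N) (hN : 2 ≤ N) (X : State n) :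
    ‖lapState G X‖ ≤ sortedEig G.lap_isHermitian ⟨N - 1, by omega⟩ * ‖X‖ := by
  refine abs_le_of_sq_le_sq' ?_ (mul_nonneg (G.sortedEig_nonneg _) (norm_nonneg _)) |>.2
  rw [mul_pow, state_norm_sq, state_norm_sq, Finset.mul_sum]
  simp_rw [Finset.mul_sum, lapState_coord]
  refine Finset.sum_le_sum fun k _ => Finset.sum_le_sum fun c _ => ?_
  rw [← Finset.mul_sum]
  exact G.norm_lap_le hN fun i => X i k c

theorem lapState_coercive {G : WGraph N} (hN : 2 ≤ N) (hG : G.graph.Connected) (X : State n)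
    (hX : ∑ i, X i = 0) :
    sortedEig G.lap_isHermitian ⟨1, by omega⟩ * ‖X‖ ^ 2 ≤ inner ℝ X (lapState G X) := by
  rw [state_norm_sq, state_inner, Finset.mul_sum]
  simp_rw [Finset.mul_sum, lapState_coord]
  refine Finset.sum_le_sum fun k _ => Finset.sum_le_sum fun c _ => ?_
  rw [← Finset.mul_sum]
  refine WGraph.lam2_mul_le hN hG (fun i => X i k c) ?_
  have := congrArg (fun x : Profile n => x k c) hX
  simpa using this

theorem inner_consensus (x : Profile n) (X : State n) :
    inner ℝ (consensus x) X = inner ℝ x (∑ i, X i) := by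
  rw [PiLp.inner_apply, inner_sum]
  rfl

theorem sum_lapState (G : WGraph N) (X : State n) : ∑ i, lapState G X i = 0 := by
  have h : ∑ i, ∑ j, G.a i j • (X i - X j) = ∑ i, ∑ j, G.a i j • (X j - X i) := by
    rw [Finset.sum_comm]
    exact Finset.sum_congr rfl fun i _ => Finset.sum_congr rfl fun j _ => by rw [G.symm]
  have h2 : ∑ i, ∑ j, G.a i j • (X i - X j) + ∑ i, ∑ j, G.a i j • (X j - X i) = 0 := by
    simp_rw [← Finset.sum_add_distrib, ← smul_add]
    simp
  rw [← h, ← two_smul ℝ, smul_eq_zero] at h2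
  exact h2.resolve_left two_ne_zero

/-- The average of the players' estimates. -/
noncomputable def average (X : State n) : Profile n := (N : ℝ)⁻¹ • ∑ i, X i

theorem sum_sub_average (hN : 2 ≤ N) (X : State n) :
    ∑ i, (X - consensus (average X)) i = 0 := by
  have hN0 : (N : ℝ) ≠ 0 := by positivity
  simp only [PiLp.sub_apply, Finset.sum_sub_distrib]
  simp [consensus, average, ← Nat.cast_smul_eq_nsmul ℝ, smul_smul, hN0]

theorem consensus_sub (x y : Profile n) : consensus (x - y) = consensus x - consensus y := rfl

theorem norm_sub_consensus_sq (hN : 2 ≤ N) (X : State n) (x : Profile n) :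
    ‖X - consensus x‖ ^ 2 = N * ‖average X - x‖ ^ 2 + ‖X - consensus (average X)‖ ^ 2 := by
  have h : X - consensus x = consensus (average X - x) + (X - consensus (average X)) := by
    rw [consensus_sub]; abel
  rw [h, norm_add_sq_real, inner_consensus, sum_sub_average hN, inner_zero_right,
    norm_consensus_sq]
  ring

/-- Consensus drops out on both sides: the Laplacian annihilates it, and its range is orthogonal to
it. Only the disagreement remains, where λ₂ is a lower bound. -/
theorem inner_lapState_ge {G : WGraph N} (hN : 2 ≤ N) (hG : G.graph.Connected) (X : State n)
    (x : Profile n) :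
    sortedEig G.lap_isHermitian ⟨1, by omega⟩ * ‖X - consensus (average X)‖ ^ 2
      ≤ inner ℝ (X - consensus x) (lapState G X) := by
  have h : X - consensus x = consensus (average X - x) + (X - consensus (average X)) := by
    rw [consensus_sub]; abel
  have h2 : lapState G X = lapState G (X - consensus (average X)) := by
    rw [lapState_sub, lapState_consensus, sub_zero]
  rw [h, inner_add_left, inner_consensus, sum_lapState, inner_zero_right, zero_add, h2]
  exact lapState_coercive hN hG _ (sum_sub_average hN X)

end LapState

/-! ### Monotonicity of the pseudogradient away from consensus -/

section Monotone

variable {N : ℕ} {n : Fin N → ℕ} {J : Fin N → Profile n → ℝ} {μ : ℝ} {θown θoth : Fin N → ℝ}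

theorem diag_sub (X Y : State n) : diag (X - Y) = diag X - diag Y := rfl

/-- By adjointness, pair `diag X - xs` = (y - xs) + w with `diagGrad J X` = D + F(y). The pairing of
y - xs with F(y) is strongly monotone; the other three are Lipschitz errors, `w` and `D` being
controlled by the distance from `X` to consensus at `y`. It is applied with `y` the average. -/
theorem inner_diagGrad_ge (hF : MapAssumption J μ θown θoth) (X : State n) {xs : Profile n}
    (hxs : gameMap J xs = 0) (y : Profile n) :
    μ * ‖y - xs‖ ^ 2 - 2 * lipConst θown θoth * ‖y - xs‖ * ‖X - consensus y‖
        - lipConst θown θoth * ‖X - consensus y‖ ^ 2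
      ≤ inner ℝ (X - consensus xs) (embed (diagGrad J X)) := by
  set θ := lipConst θown θoth
  set D := diagGrad J X - gameMap J y
  have hθ : 0 ≤ θ := lipConst_nonneg _ _
  have hD : ‖D‖ ≤ θ * ‖X - consensus y‖ := diagGrad_lipschitz hF X (consensus y)
  have hFy : ‖gameMap J y‖ ≤ θ * ‖y - xs‖ := by
    have := gameMap_lipschitz hF y xs
    rwa [hxs, sub_zero] at this
  set w := diag X - y
  have hw : ‖w‖ ≤ ‖X - consensus y‖ := norm_diag_le (X - consensus y)
  have hmono : μ * ‖y - xs‖ ^ 2 ≤ inner ℝ (y - xs) (gameMap J y) := by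
    have := hF.stronglyMonotone y xs
    rwa [hxs, sub_zero, real_inner_comm] at this
  have hsplit : inner ℝ (X - consensus xs) (embed (diagGrad J X))
      = inner ℝ (y - xs) D + inner ℝ (y - xs) (gameMap J y) + inner ℝ w D
        + inner ℝ w (gameMap J y) := by
    rw [inner_embed, diag_sub, diag_consensus]
    have e1 : diag X - xs = (y - xs) + w := by simp only [w]; abel
    have e2 : diagGrad J X = D + gameMap J y := by simp only [D]; abel
    rw [e1, e2, inner_add_left, inner_add_right, inner_add_right]
    ring
  have b1 := (abs_le.1 (abs_real_inner_le_norm (y - xs) D)).1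
  have b2 := (abs_le.1 (abs_real_inner_le_norm w D)).1
  have b3 := (abs_le.1 (abs_real_inner_le_norm w (gameMap J y))).1
  have c1 : ‖y - xs‖ * ‖D‖ ≤ ‖y - xs‖ * (θ * ‖X - consensus y‖) := by gcongr
  have c2 : ‖w‖ * ‖D‖ ≤ ‖X - consensus y‖ * (θ * ‖X - consensus y‖) := by gcongr
  have c3 : ‖w‖ * ‖gameMap J y‖ ≤ ‖X - consensus y‖ * (θ * ‖y - xs‖) := by gcongr
  rw [hsplit]
  nlinarith

end Monotone

/-! ### The constant ν -/

section Nu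

variable {K : Consts} {p : Params}

theorem inner_nuMatrix (v : EuclideanSpace ℝ (Fin 2)) :
    inner ℝ v (Matrix.toEuclideanLin (nuMatrix K p) v)
      = K.μ / K.N * v 0 ^ 2 - 2 * (K.θ / √K.N) * (v 0 * v 1)
        + (p.α * K.lam2 / p.ε - K.θ) * v 1 ^ 2 := by
  rw [inner_toEuclideanLin]
  simp [Fin.sum_univ_two, nuMatrix]
  ring

/-- Evaluate the form at (√N·a, b): its squared norm Na² + b² is the squared distance to consensus
when `a` measures the average and `b` the disagreement. -/
theorem nu_quadratic_le (a b : ℝ) (hN : 0 < K.N) :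
    nu K p / 2 * (K.N * a ^ 2 + b ^ 2)
      ≤ K.μ * a ^ 2 - 2 * K.θ * a * b + (p.α * K.lam2 / p.ε - K.θ) * b ^ 2 := by
  have hN' : (0 : ℝ) < K.N := by exact_mod_cast hN
  have h := sortedEig_mul_norm_sq_le (nuMatrix_isHermitian K p) (k := 0) (fun j => Fin.zero_le j)
    (WithLp.toLp 2 ![√K.N * a, b])
  rw [inner_nuMatrix, EuclideanSpace.real_norm_sq_eq, Fin.sum_univ_two] at h
  simp only [Matrix.cons_val_zero, Matrix.cons_val_one, mul_pow, Real.sq_sqrt hN'.le] at h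
  have e1 : K.μ / K.N * (K.N * a ^ 2) = K.μ * a ^ 2 := by field_simp
  have hs : √(K.N : ℝ) ≠ 0 := (Real.sqrt_pos.2 hN').ne'
  have e2 : 2 * (K.θ / √K.N) * (√K.N * a * b) = 2 * K.θ * a * b := by field_simp
  rw [e1, e2] at h
  rw [nu]
  linarith

/-- Completing the square leaves the Schur complement `d`, whose positivity is exactly the lower
bound on α. -/
theorem nu_pos (hN : 0 < K.N) (hμ : 0 < K.μ) (hlam : 0 < K.lam2) (hε : 0 < p.ε)
    (hα : p.ε / K.lam2 * (K.θ ^ 2 / K.μ + K.θ) < p.α) : 0 < nu K p := by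
  have hN' : (0 : ℝ) < K.N := by exact_mod_cast hN
  refine mul_pos two_pos (sortedEig_pos_of_inner_pos _ (fun v hv => ?_) 0)
  rw [inner_nuMatrix]
  set d := p.α * K.lam2 / p.ε - K.θ - K.θ ^ 2 / K.μ with hd
  have hd0 : 0 < d := by
    have h1 : K.θ ^ 2 / K.μ + K.θ < p.α * K.lam2 / p.ε := by
      rw [lt_div_iff₀ hε]
      have := mul_lt_mul_of_pos_right hα hlam
      calc (K.θ ^ 2 / K.μ + K.θ) * p.ε
          = p.ε / K.lam2 * (K.θ ^ 2 / K.μ + K.θ) * K.lam2 := by field_simp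
        _ < _ := this
    linarith
  have hs : 0 < √(K.N : ℝ) := Real.sqrt_pos.2 hN'
  have hsq : √(K.N : ℝ) ^ 2 = K.N := Real.sq_sqrt hN'.le
  have hkey : K.μ / K.N * v 0 ^ 2 - 2 * (K.θ / √K.N) * (v 0 * v 1)
        + (p.α * K.lam2 / p.ε - K.θ) * v 1 ^ 2
      = K.μ * (v 0 / √K.N - K.θ / K.μ * v 1) ^ 2 + d * v 1 ^ 2 := by
    have hsq' : K.μ / K.N = K.μ / √K.N ^ 2 := by rw [hsq]
    rw [hd, hsq']
    field_simp
    ring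
  rw [hkey]
  by_cases h1 : v 1 = 0
  · have h0 : v 0 ≠ 0 := by
      intro h0
      refine hv ?_
      ext i
      fin_cases i
      · exact h0
      · exact h1
    rw [h1]
    have : 0 < (v 0 / √K.N) ^ 2 := by positivity
    simpa using mul_pos hμ this
  · have : 0 < d * v 1 ^ 2 := by positivity
    nlinarith [mul_nonneg hμ.le (sq_nonneg (v 0 / √K.N - K.θ / K.μ * v 1))]

/-- The parameters enter ν only through α/ε, so along α = cε it is constant. -/
theorem nu_congr {p' : Params} (h : p.α * K.lam2 / p.ε = p'.α * K.lam2 / p'.ε) :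
    nu K p = nu K p' := by
  rw [nu, nu, sortedEig_congr (nuMatrix_isHermitian K p) (nuMatrix_isHermitian K p')]
  rw [nuMatrix, nuMatrix, h]

end Nu

/-! ### Quantization error without saturation -/

section Quantizer

/-- Saturation is harmless up to half a step beyond the top level: there the output `L` is still a
nearest level. -/
theorem abs_quant_sub_le {L : ℕ} {x : ℝ} (hx : |x| ≤ L + 1 / 2) : |(quant L x : ℝ) - x| ≤ 1 / 2 := by
  have key : ∀ y : ℝ, 0 ≤ y → y ≤ L + 1 / 2 →
      |((min ⌊y + 1 / 2⌋ (L : ℤ) : ℤ) : ℝ) - y| ≤ 1 / 2 := by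
    intro y hy0 hy
    have h1 := Int.floor_le (y + 1 / 2)
    have h2 := Int.lt_floor_add_one (y + 1 / 2)
    push_cast
    rw [abs_le]
    rcases le_total (⌊y + 1 / 2⌋ : ℝ) (L : ℝ) with h | h
    · rw [min_eq_left h]
      constructor <;> linarith
    · rw [min_eq_right h]
      constructor <;> linarith
  rw [abs_le] at hx
  unfold quant
  split_ifs with h1 h2
  · rw [abs_le]
    push_cast
    constructor <;> linarith [h1.1, h1.2]
  · exact key x (by linarith) hx.2
  · have h3 : x ≤ -(1 / 2) := by
      by_contra h
      exact h1 ⟨not_le.1 h, not_le.1 h2⟩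
    have := key (-x) (by linarith) (by linarith)
    rw [← abs_neg] at this
    push_cast at this ⊢
    convert this using 2
    ring

variable {N : ℕ} {n : Fin N → ℕ}

theorem abs_decode_sub_le {L : ℕ} {s : ℝ} (hs : 0 < s) {v w : Profile n}
    (h : ∀ i c, |v i c - w i c| ≤ (L + 1 / 2) * s) (i : Fin N) (c : Fin (n i)) :
    |(w + s • (encode L s v w).toProfile) i c - v i c| ≤ s / 2 := by
  have h1 : |(v i c - w i c) / s| ≤ L + 1 / 2 := by
    rw [abs_div, abs_of_pos hs, div_le_iff₀ hs]
    exact h i c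
  have h2 := abs_quant_sub_le h1
  have e : (w + s • (encode L s v w).toProfile) i c - v i c
      = s * ((quant L ((v i c - w i c) / s) : ℝ) - (v i c - w i c) / s) := by
    simp only [PiLp.add_apply, PiLp.smul_apply, Message.toProfile, encode, smul_eq_mul]
    field_simp
    ring
  rw [e, abs_mul, abs_of_pos hs]
  nlinarith

theorem abs_coord_le_norm (X : State n) (i k : Fin N) (c : Fin (n k)) : |X i k c| ≤ ‖X‖ := by
  calc |X i k c| = ‖X i k c‖ := rfl
    _ ≤ ‖X i k‖ := PiLp.norm_apply_le (X i k) c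
    _ ≤ ‖X i‖ := PiLp.norm_apply_le (X i) k
    _ ≤ ‖X‖ := PiLp.norm_apply_le X i

theorem norm_le_of_abs_coord_le {X : State n} {r : ℝ} (hr : 0 ≤ r)
    (h : ∀ i k (c : Fin (n k)), |X i k c| ≤ r) :
    ‖X‖ ≤ √((N : ℝ) * (∑ i, n i : ℕ)) * r := by
  refine abs_le_of_sq_le_sq' ?_ (by positivity) |>.2
  rw [mul_pow, Real.sq_sqrt (by positivity), state_norm_sq]
  have h1 : ∑ k, ∑ c : Fin (n k), ∑ i, X i k c ^ 2 ≤ ∑ k, ∑ c : Fin (n k), ∑ i : Fin N, r ^ 2 := by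
    refine Finset.sum_le_sum fun k _ => Finset.sum_le_sum fun c _ => Finset.sum_le_sum fun i _ => ?_
    rw [← sq_abs]
    exact pow_le_pow_left₀ (abs_nonneg _) (h i k c) 2
  refine h1.trans_eq ?_
  simp [← Finset.sum_mul]
  ring

end Quantizer

/-! ### Bandwidth of periodic sampling -/

section Bandwidth

variable {N : ℕ}

/-- The extra 1 counts the sample at time 0. -/
theorem finsum_sampling_eq {T t b : ℝ} (hT : 0 < T) (ht : 0 ≤ t) :
    ∑ᶠ (k : ℕ) (_ : (k : ℝ) * T ≤ t), b = (⌊t / T⌋₊ + 1 : ℕ) * b := by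
  have h : ∀ k : ℕ, (k : ℝ) * T ≤ t ↔ k ∈ Finset.range (⌊t / T⌋₊ + 1) := by
    intro k
    rw [Finset.mem_range, Nat.lt_succ_iff, Nat.le_floor_iff (by positivity), le_div_iff₀ hT]
  simp_rw [h]
  rw [finsum_mem_finset_eq_sum (fun _ : ℕ => b)]
  simp

theorem tendsto_sampling_rate {T b : ℝ} (hT : 0 < T) :
    Tendsto (fun t : ℝ => (1 / t) * ∑ᶠ (k : ℕ) (_ : (k : ℝ) * T ≤ t), b) atTop (𝓝 (b / T)) := by
  have h1 : Tendsto (fun t : ℝ => (⌊T⁻¹ * t⌋₊ : ℝ) / t) atTop (𝓝 T⁻¹) :=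
    tendsto_nat_floor_mul_div_atTop (by positivity)
  have h2 : Tendsto (fun t : ℝ => (⌊T⁻¹ * t⌋₊ : ℝ) / t * b + t⁻¹ * b) atTop
      (𝓝 (T⁻¹ * b + 0 * b)) :=
    (h1.mul_const b).add (tendsto_inv_atTop_zero.mul_const b)
  have e : T⁻¹ * b + 0 * b = b / T := by ring
  rw [e] at h2
  refine h2.congr' ?_
  filter_upwards [eventually_gt_atTop 0] with t ht
  rw [finsum_sampling_eq hT ht.le, inv_mul_eq_div T t]
  push_cast
  field_simp

theorem algBandwidth_eq {G : WGraph N} (hN : 2 ≤ N) (hG : G.graph.Connected) (K : Consts)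
    (p : Params) (hT : 0 < p.T) :
    algBandwidth G K p = ((bitsPerSample K p.L / p.T : ℝ) : EReal) := by
  have hlim : limsup (fun t' : ℝ => (((1 / t') * ∑ᶠ (k : ℕ) (_ : (k : ℝ) * p.T ≤ t'),
      bitsPerSample K p.L : ℝ) : EReal)) atTop = ((bitsPerSample K p.L / p.T : ℝ) : EReal) :=
    ((continuous_coe_real_ereal.tendsto _).comp (tendsto_sampling_rate hT)).limsup_eq
  unfold algBandwidth bandwidth
  simp_rw [hlim]
  -- The supremum over an empty edge set would be ⊥; connectedness with at least two players
  -- supplies an edge.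
  have : Nontrivial (Fin N) := Fin.nontrivial_iff_two_le.2 hN
  obtain ⟨i⟩ := hG.nonempty
  obtain ⟨j, hj⟩ := hG.preconnected.exists_adj_of_nontrivial i
  refine le_antisymm (iSup_le fun _ => iSup_le fun _ => iSup_le fun _ => le_rfl) ?_
  exact le_iSup_of_le i (le_iSup_of_le j (le_iSup_of_le hj le_rfl))

end Bandwidth

/-! ### Existence of trajectories -/

section Existence

/-- For a Lipschitz vector field the Picard iteration converges on an interval whose length is at
most half the inverse of the Lipschitz constant. -/
theorem exists_solution_of_lipschitz {E : Type*} [NormedAddCommGroup E] [NormedSpace ℝ E]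
    [CompleteSpace E] {f : E → E} {κ : NNReal} (hf : LipschitzWith κ f) {T : ℝ} (hT : 0 ≤ T)
    (hκT : κ * T ≤ 1 / 2) (x₀ : E) :
    ∃ φ : ℝ → E, φ 0 = x₀ ∧ ∀ t ∈ Icc 0 T, HasDerivWithinAt φ (f (φ t)) (Icc 0 T) t := by
  -- On the ball of this radius the speed is at most ‖f x₀‖ + κa, so in time `T` the solution moves
  -- at most a/2 + κTa ≤ a.
  set a : NNReal := ⟨2 * T * ‖f x₀‖, by positivity⟩ with ha
  have hpl : IsPicardLindelof (fun _ => f) (⟨0, le_rfl, hT⟩ : Icc 0 T) x₀ a 0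
      (‖f x₀‖₊ + κ * a) κ := by
    refine IsPicardLindelof.of_time_independent (fun x hx => ?_) hf.lipschitzOnWith ?_
    · push_cast
      have h1 := hf.norm_sub_le x x₀
      have h2 : ‖x - x₀‖ ≤ a := by rwa [← dist_eq_norm, ← Metric.mem_closedBall]
      have h3 : (κ : ℝ) * ‖x - x₀‖ ≤ κ * a := by gcongr
      have h4 := norm_le_norm_sub_add (f x) (f x₀)
      linarith
    · simp only [sub_zero, NNReal.coe_zero, sub_self]
      rw [max_eq_left hT]
      push_cast
      have h1 : (a : ℝ) = 2 * T * ‖f x₀‖ := rfl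
      have h2 : (κ * T) * a ≤ 1 / 2 * a := by gcongr
      rw [h1] at h2 ⊢
      linarith
  exact hpl.exists_eq_forall_mem_Icc_hasDerivWithinAt₀

theorem continuousOn_Ici_of_forall_Icc {E : Type*} [TopologicalSpace E] {f : ℝ → E} {T : ℝ}
    (hT : 0 < T) (h : ∀ k : ℕ, ContinuousOn f (Icc (k * T) ((k + 1) * T))) :
    ContinuousOn f (Ici 0) := by
  have h1 : ∀ k : ℕ, ContinuousOn f (Icc 0 (k * T)) := by
    intro k
    induction k with
    | zero => simp
    | succ k ih =>
      have hu : Icc 0 ((k + 1 : ℕ) * T) = Icc 0 (k * T) ∪ Icc (k * T) ((k + 1) * T) := by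
        rw [Icc_union_Icc_eq_Icc (by positivity) (by nlinarith)]
        push_cast; rfl
      rw [hu]
      exact ih.union_of_isClosed (h k) isClosed_Icc isClosed_Icc
  intro t ht
  obtain ⟨k, hk⟩ := exists_nat_gt (t / T)
  rw [div_lt_iff₀ hT] at hk
  refine (h1 k t ⟨ht, hk.le⟩).mono_of_mem_nhdsWithin ?_
  rw [mem_nhdsWithin]
  exact ⟨Iio (k * T), isOpen_Iio, hk, fun x hx => ⟨hx.2, hx.1.le⟩⟩

variable {N : ℕ} {n : Fin N → ℕ} {J : Fin N → Profile n → ℝ} {μ : ℝ} {θown θoth : Fin N → ℝ}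

/-- The right-hand side of the dynamics between two sampling instants, with decoded states `H`. -/
noncomputable def field (J : Fin N → Profile n → ℝ) (G : WGraph N) (p : Params)
    (H X : State n) : State n :=
  -(p.α • lapState G H) - p.ε • embed (diagGrad J X)

theorem field_apply (G : WGraph N) (p : Params) (H X : State n) (i : Fin N) :
    field J G p H X i = p.α • ∑ j, G.a i j • (H j - H i)
      - (WithLp.toLp 2 (Pi.single i (p.ε • ownGrad J i (X i))) : Profile n) := by
  have h1 : lapState G H i = -∑ j, G.a i j • (H j - H i) := by
    simp only [lapState, ← Finset.sum_neg_distrib, ← smul_neg, neg_sub]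
  have h2 : p.ε • embed (diagGrad J X) i
      = (WithLp.toLp 2 (Pi.single i (p.ε • ownGrad J i (X i))) : Profile n) := by
    ext j c
    by_cases h : j = i
    · subst h; simp [embed, diagGrad]
    · simp [embed, h]
  simp only [field, PiLp.sub_apply, PiLp.neg_apply, PiLp.smul_apply]
  rw [h1, h2, smul_neg, neg_neg]

theorem field_lipschitz (hF : MapAssumption J μ θown θoth) (G : WGraph N) {p : Params}
    (hε : 0 ≤ p.ε) (H : State n) :
    LipschitzWith (p.ε * lipConst θown θoth).toNNReal (field J G p H) := by
  refine LipschitzWith.of_dist_le_mul fun X Y => ?_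
  rw [Real.coe_toNNReal _ (mul_nonneg hε (lipConst_nonneg _ _)), dist_eq_norm, dist_eq_norm]
  have e : field J G p H X - field J G p H Y
      = -(p.ε • embed (diagGrad J X - diagGrad J Y)) := by
    rw [field, field, embed_sub, smul_sub]; abel
  rw [e, norm_neg, norm_smul, norm_embed, Real.norm_of_nonneg hε, mul_assoc]
  gcongr
  exact diagGrad_lipschitz hF X Y

/-- Trajectories exist from every initial state once the sampling period is short compared with
the Lipschitz constant of the dynamics. -/
theorem exists_isTrajectory (hF : MapAssumption J μ θown θoth) (G : WGraph N) (K : Consts)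
    {p : Params} (hε : 0 ≤ p.ε) (hT : 0 < p.T) (hs : p.ε * lipConst θown θoth * p.T ≤ 1 / 2)
    (x₀ : Fin N → Profile n) : ∃ x, IsTrajectory J G K p x ∧ x 0 = x₀ := by
  have hsol : ∀ H Y : State n, ∃ φ : ℝ → State n, φ 0 = Y ∧ ∀ t ∈ Icc 0 p.T,
      HasDerivWithinAt φ (field J G p H (φ t)) (Icc 0 p.T) t := fun H Y =>
    exists_solution_of_lipschitz (field_lipschitz hF G hε H) hT.le
      (by rwa [Real.coe_toNNReal _ (mul_nonneg hε (lipConst_nonneg _ _))]) Y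
  choose φ hφ0 hφ using hsol
  let s := scale K p
  -- The pair (state at kT, decoded values after sample k) evolves autonomously: flow for time `T`
  -- with the decoded values frozen, then encode. The trajectory is glued from the flows, and `hhat`
  -- confirms that its own samples reproduce these decoded values.
  let seq : ℕ → State n × State n := fun k => Nat.rec
    (WithLp.toLp 2 x₀, WithLp.toLp 2 fun j => s 0 • (encode p.L (s 0) (x₀ j) 0).toProfile)
    (fun k z => (φ z.2 z.1 p.T, WithLp.toLp 2 fun j => z.2 j + s (k + 1) •
      (encode p.L (s (k + 1)) (φ z.2 z.1 p.T j) (z.2 j)).toProfile)) k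
  have hseq : ∀ k, seq (k + 1) = (φ (seq k).2 (seq k).1 p.T,
      WithLp.toLp 2 fun j => (seq k).2 j + s (k + 1) •
      (encode p.L (s (k + 1)) (φ (seq k).2 (seq k).1 p.T j) ((seq k).2 j)).toProfile) :=
    fun k => rfl
  let piece : ℕ → ℝ → State n := fun k t => φ (seq k).2 (seq k).1 (t - k * p.T)
  let x : ℝ → Fin N → Profile n := fun t j => piece ⌊t / p.T⌋₊ t j
  have hfloor : ∀ (k : ℕ), ∀ t ∈ Ico (k * p.T) ((k + 1) * p.T), ⌊t / p.T⌋₊ = k := by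
    intro k t ht
    rw [Nat.floor_eq_iff (div_nonneg (le_trans (by positivity) ht.1) hT.le)]
    exact ⟨(le_div_iff₀ hT).2 ht.1, (div_lt_iff₀ hT).2 ht.2⟩
  have hx : ∀ (k : ℕ), ∀ t ∈ Ico (k * p.T) ((k + 1) * p.T), ∀ j, x t j = piece k t j := by
    intro k t ht j
    simp only [x, hfloor k t ht]
  have hleft : ∀ k : ℕ, (k : ℝ) * p.T ∈ Ico (k * p.T) ((k + 1) * p.T) := fun k =>
    ⟨le_rfl, by nlinarith⟩
  have hsample : ∀ (k : ℕ) j, x (k * p.T) j = (seq k).1 j := by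
    intro k j
    rw [hx k _ (hleft k)]
    simp only [piece, sub_self, hφ0]
  have hend : ∀ (k : ℕ) j, x ((k + 1) * p.T) j = piece k ((k + 1) * p.T) j := by
    intro k j
    have h1 := hsample (k + 1) j
    push_cast at h1
    rw [h1, hseq]
    have e : (k + 1) * p.T - k * p.T = p.T := by ring
    simp only [piece, e]
  have hhat : ∀ (k : ℕ) j, hat K p x j k = (seq k).2 j := by
    intro k j
    induction k with
    | zero =>
      have h0 := hsample 0 j
      change s 0 • (encode p.L (s 0) (x ((0 : ℕ) * p.T) j) 0).toProfile = _
      rw [h0]; rfl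
    | succ k ih =>
      have h1 := hsample (k + 1) j
      change hat K p x j k + s (k + 1) •
        (encode p.L (s (k + 1)) (x ((k + 1 : ℕ) * p.T) j) (hat K p x j k)).toProfile = _
      rw [h1, ih, hseq]
  have hpiece : ∀ (k : ℕ), ∀ t ∈ Icc (k * p.T) ((k + 1) * p.T),
      HasDerivWithinAt (piece k) (field J G p (seq k).2 (piece k t))
        (Icc (k * p.T) ((k + 1) * p.T)) t := by
    intro k t ht
    have hmem : t - k * p.T ∈ Icc 0 p.T := ⟨by linarith [ht.1], by linarith [ht.2]⟩
    have h1 := (hφ (seq k).2 (seq k).1 (t - k * p.T) hmem).scomp t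
      (h' := 1) (h := fun t => t - k * p.T) (s := Icc (k * p.T) ((k + 1) * p.T))
      ((hasDerivWithinAt_id t _).sub_const _)
      (fun u hu => ⟨by linarith [hu.1], by linarith [hu.2]⟩)
    rw [one_smul] at h1
    exact h1
  have hproj : ∀ (k : ℕ) (i : Fin N), ∀ t ∈ Icc (k * p.T) ((k + 1) * p.T),
      HasDerivWithinAt (fun τ => piece k τ i) (field J G p (seq k).2 (piece k t) i)
        (Icc (k * p.T) ((k + 1) * p.T)) t := fun k i t ht =>
    (PiLp.proj (𝕜 := ℝ) 2 (fun _ : Fin N => Profile n) i).hasFDerivAt.comp_hasDerivWithinAt t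
      (hpiece k t ht)
  refine ⟨x, ⟨fun i => continuousOn_Ici_of_forall_Icc hT fun k => ?_, fun i k t ht => ?_⟩, ?_⟩
  · refine ContinuousOn.congr (fun t ht => (hproj k i t ht).continuousWithinAt) fun t ht => ?_
    rcases ht.2.lt_or_eq with h | h
    · exact hx k t ⟨ht.1, h⟩ i
    · rw [h]; exact hend k i
  · have h1 := ((hproj k i t (Ico_subset_Icc_self ht)).mono Ico_subset_Icc_self).congr
      (fun u hu => hx k u hu i) (hx k t ht i)
    rw [field_apply] at h1
    simp_rw [hhat]
    have e : x t i = piece k t i := hx k t ht i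
    rw [e]
    exact h1
  · funext j
    have := hsample 0 j
    rw [Nat.cast_zero, zero_mul] at this
    exact this

end Existence

/-! ### Trajectories as curves of states -/

section Trajectory

variable {N : ℕ} {n : Fin N → ℕ} {J : Fin N → Profile n → ℝ} {G : WGraph N} {K : Consts}
  {p : Params} {x : ℝ → Fin N → Profile n}

theorem IsTrajectory.continuousOn_state (hx : IsTrajectory J G K p x) :
    ContinuousOn (fun t => (WithLp.toLp 2 (x t) : State n)) (Ici 0) :=
  (PiLp.continuous_toLp 2 _).comp_continuousOn (continuousOn_pi.2 hx.continuousOn)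

theorem IsTrajectory.hasDerivWithinAt_state (hx : IsTrajectory J G K p x) (k : ℕ) {t : ℝ}
    (ht : t ∈ Ico (k * p.T) ((k + 1) * p.T)) :
    HasDerivWithinAt (fun t => (WithLp.toLp 2 (x t) : State n))
      (field J G p (WithLp.toLp 2 fun j => hat K p x j k) (WithLp.toLp 2 (x t))) (Ici t) t := by
  have h1 : HasDerivWithinAt x (fun i => field J G p (WithLp.toLp 2 fun j => hat K p x j k)
      (WithLp.toLp 2 (x t)) i) (Ico (k * p.T) ((k + 1) * p.T)) t := by
    refine hasDerivWithinAt_pi.2 fun i => ?_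
    rw [field_apply]
    exact hx.ode i k t ht
  have h2 := (PiLp.hasFDerivAt_toLp (𝕜 := ℝ) 2 (x t)).comp_hasDerivWithinAt t h1
  refine HasDerivWithinAt.mono_of_mem_nhdsWithin h2 ?_
  rw [mem_nhdsWithin]
  exact ⟨Iio ((k + 1) * p.T), isOpen_Iio, ht.2, fun u hu => ⟨ht.1.trans hu.2, hu.1⟩⟩

end Trajectory

/-! ### Estimates between two sampling instants -/

section Interval

variable {N : ℕ} {n : Fin N → ℕ} {J : Fin N → Profile n → ℝ} {G : WGraph N} {μ : ℝ}
  {θown θoth : Fin N → ℝ} {M M' : ℝ} {K : Consts} {p : Params} {xs : Profile n}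

theorem inner_field_le (hN : 2 ≤ N) (hG : G.graph.Connected) (hF : MapAssumption J μ θown θoth)
    (hK : K = consts hN n G μ θown θoth M M') (hxs : gameMap J xs = 0) (hε : 0 < p.ε)
    (hα : 0 ≤ p.α) (H X : State n) :
    inner ℝ (X - consensus xs) (field J G p H X)
      ≤ -(p.ε * nu K p / 2) * ‖X - consensus xs‖ ^ 2
        + p.α * K.lamN * ‖X - consensus xs‖ * ‖H - X‖ := by
  have h1 := inner_lapState_ge hN hG X xs
  have h2 := inner_diagGrad_ge hF X hxs (average X)
  have h3 := nu_quadratic_le (K := K) (p := p) ‖average X - xs‖ ‖X - consensus (average X)‖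
    (by rw [hK]; simp only [consts]; omega)
  have h4 := norm_sub_consensus_sq hN X xs
  have h5 : -inner ℝ (X - consensus xs) (lapState G (H - X))
      ≤ ‖X - consensus xs‖ * (K.lamN * ‖H - X‖) := by
    refine (neg_le_abs _).trans ((abs_real_inner_le_norm _ _).trans ?_)
    gcongr
    have := norm_lapState_le G hN (H - X)
    rw [hK]
    exact this
  have hs : field J G p H X = -(p.α • lapState G X) - p.α • lapState G (H - X)
      - p.ε • embed (diagGrad J X) := by
    rw [field, lapState_sub, smul_sub]; abel
  have eN : (K.N : ℝ) = N := by rw [hK]; rfl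
  have eμ : K.μ = μ := by rw [hK]; rfl
  have eθ : K.θ = lipConst θown θoth := by rw [hK]; rfl
  have e2 : K.lam2 = sortedEig G.lap_isHermitian ⟨1, by omega⟩ := by rw [hK]; rfl
  rw [eN, eμ, eθ, ← h4] at h3
  rw [← e2] at h1
  rw [hs, inner_sub_right, inner_sub_right, inner_neg_right, inner_smul_right, inner_smul_right,
    inner_smul_right]
  set u := ‖X - consensus xs‖
  set q := ‖X - consensus (average X)‖
  set a := ‖average X - xs‖
  have h6 := mul_le_mul_of_nonneg_left h1 hα
  have h7 := mul_le_mul_of_nonneg_left h2 hε.le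
  have h8 := mul_le_mul_of_nonneg_left h3 hε.le
  have h9 := mul_le_mul_of_nonneg_left h5 hα
  have e : p.ε * (p.α * K.lam2 / p.ε * q ^ 2) = p.α * (K.lam2 * q ^ 2) := by field_simp
  have e' : p.ε * (μ * a ^ 2 - 2 * lipConst θown θoth * a * q
      + (p.α * K.lam2 / p.ε - lipConst θown θoth) * q ^ 2)
      = p.ε * (μ * a ^ 2 - 2 * lipConst θown θoth * a * q - lipConst θown θoth * q ^ 2)
        + p.α * (K.lam2 * q ^ 2) := by rw [← e]; ring
  rw [e'] at h8
  linarith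

/-- Between sampling instants the state drifts away slowly. -/
theorem norm_drift_le (hN : 2 ≤ N) (hF : MapAssumption J μ θown θoth)
    (hK : K = consts hN n G μ θown θoth M M') (hxs : gameMap J xs = 0) (hθ : 0 < K.θ)
    (hε : 0 < p.ε) (hα : 0 ≤ p.α) {X : ℝ → State n} {H : State n} {a b R η : ℝ}
    (hcont : ContinuousOn X (Icc a b))
    (hder : ∀ t ∈ Ico a b, HasDerivWithinAt X (field J G p H (X t)) (Ici t) t)
    (hδ : ‖X a - consensus xs‖ ≤ R) (he : ‖H - X a‖ ≤ η * R) :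
    ∀ t ∈ Icc a b, ‖X t - X a‖
      ≤ (p.α * K.lamN * (η + 1) + p.ε * K.θ) * R / (p.ε * K.θ)
        * (Real.exp (p.ε * K.θ * (t - a)) - 1) := by
  have hlap : ‖lapState G H‖ ≤ K.lamN * ((η + 1) * R) := by
    have h1 : lapState G H = lapState G (H - consensus xs) := by
      rw [lapState_sub, lapState_consensus, sub_zero]
    have h2 := norm_lapState_le G hN (H - consensus xs)
    have h3 : ‖H - consensus xs‖ ≤ (η + 1) * R := by
      have := norm_sub_le_norm_sub_add_norm_sub H (X a) (consensus xs)
      linarith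
    have e : K.lamN = sortedEig G.lap_isHermitian ⟨N - 1, by omega⟩ := by rw [hK]; rfl
    rw [h1, e]
    exact h2.trans (mul_le_mul_of_nonneg_left h3 (G.sortedEig_nonneg _))
  have eθ : K.θ = lipConst θown θoth := by rw [hK]; rfl
  have hgrad : ∀ t, ‖diagGrad J (X t)‖ ≤ K.θ * (‖X t - X a‖ + R) := by
    intro t
    have h1 := diagGrad_lipschitz hF (X t) (consensus xs)
    rw [diagGrad_consensus, hxs, sub_zero, ← eθ] at h1
    refine h1.trans (mul_le_mul_of_nonneg_left ?_ hθ.le)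
    have := norm_sub_le_norm_sub_add_norm_sub (X t) (X a) (consensus xs)
    linarith
  intro t ht
  -- The displacement starts at 0, and its speed is at most εθ times itself plus a constant multiple
  -- of `R`; Grönwall applies.
  have key := norm_le_gronwallBound_of_norm_deriv_right_le (f := fun t => X t - X a)
    (f' := fun t => field J G p H (X t)) (δ := 0) (K := p.ε * K.θ)
    (ε := (p.α * K.lamN * (η + 1) + p.ε * K.θ) * R) (a := a) (b := b)
    (hcont.sub continuousOn_const) (fun t ht => (hder t ht).sub_const _) (by simp) ?_ t ht
  · rw [gronwallBound_of_K_ne_0 (by positivity)] at key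
    simpa using key
  · intro t _
    have h1 : ‖field J G p H (X t)‖ ≤ p.α * ‖lapState G H‖ + p.ε * ‖diagGrad J (X t)‖ := by
      refine (norm_sub_le _ _).trans_eq ?_
      rw [norm_neg, norm_smul, norm_smul, norm_embed, Real.norm_of_nonneg hα,
        Real.norm_of_nonneg hε.le]
    have h2 := mul_le_mul_of_nonneg_left hlap hα
    have h3 := mul_le_mul_of_nonneg_left (hgrad t) hε.le
    linarith

/-- Exponential decay of the distance to the equilibrium while the quantization error decays
exponentially. -/
theorem norm_sub_consensus_le (hN : 2 ≤ N) (hG : G.graph.Connected)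
    (hF : MapAssumption J μ θown θoth) (hK : K = consts hN n G μ θown θoth M M')
    (hxs : gameMap J xs = 0) (hε : 0 < p.ε) (hα : 0 ≤ p.α) (hlam : 0 ≤ K.lamN)
    {X : ℝ → State n} {H : State n} {a b A η γ κ : ℝ} (hA : 0 ≤ A)
    (hκ0 : 0 ≤ κ) (hκ : κ = p.ε * nu K p / 2 - γ) (hη : p.α * K.lamN * η = κ)
    (hcont : ContinuousOn X (Icc a b))
    (hder : ∀ t ∈ Ico a b, HasDerivWithinAt X (field J G p H (X t)) (Ici t) t)
    (he : ∀ t ∈ Icc a b, ‖H - X t‖ ≤ η * (A * Real.exp (-γ * t)))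
    (hδ : ‖X a - consensus xs‖ ≤ A * Real.exp (-γ * a)) :
    ∀ t ∈ Icc a b, ‖X t - consensus xs‖ ≤ A * Real.exp (-γ * t) := by
  have hequiv : ∀ t, ‖X t - consensus xs‖ ≤ A * Real.exp (-γ * t) ↔
      Real.exp (κ * t) * (Real.exp (2 * γ * t) * ‖X t - consensus xs‖ ^ 2 - A ^ 2) ≤ 0 := by
    intro t
    have e1 : Real.exp (2 * γ * t) = Real.exp (γ * t) ^ 2 := by
      rw [← Real.exp_nat_mul]; congr 1; push_cast; ring
    have e2 : A * Real.exp (-γ * t) = A / Real.exp (γ * t) := by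
      rw [neg_mul, Real.exp_neg]; rfl
    have hz : ∀ z : ℝ, Real.exp (κ * t) * z ≤ 0 ↔ z ≤ 0 := fun z => by
      rw [← not_lt, mul_pos_iff_of_pos_left (Real.exp_pos _), not_lt]
    rw [hz, sub_nonpos, e1, ← mul_pow, e2, le_div_iff₀ (Real.exp_pos _),
      pow_le_pow_iff_left₀ (by positivity) hA two_ne_zero, mul_comm]
  intro t ht
  rw [hequiv]
  -- With w = e^{γt}‖X - x*‖, the energy estimate gives (w²)' ≤ -2κw² + 2κAw ≤ -κ(w² - A²), so
  -- e^{κt}(w² - A²) is nonincreasing. Squaring avoids the nondifferentiability of the norm at 0.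
  refine image_le_of_deriv_right_le_deriv_boundary
    (f := fun t => Real.exp (κ * t)
      * (Real.exp (2 * γ * t) * ‖X t - consensus xs‖ ^ 2 - A ^ 2))
    (f' := fun t => Real.exp (κ * t) * κ
        * (Real.exp (2 * γ * t) * ‖X t - consensus xs‖ ^ 2 - A ^ 2)
      + Real.exp (κ * t) * (Real.exp (2 * γ * t) * (2 * γ) * ‖X t - consensus xs‖ ^ 2
        + Real.exp (2 * γ * t) * (2 * inner ℝ (X t - consensus xs) (field J G p H (X t)))))
    (B := fun _ => 0) (B' := fun _ => 0) ?_ ?_ ((hequiv a).1 hδ) continuousOn_const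
    (fun _ _ => hasDerivWithinAt_const _ _ _) ?_ ht
  · have : ContinuousOn (fun t => X t - consensus xs) (Icc a b) := hcont.sub continuousOn_const
    fun_prop
  · intro t ht
    have h1 : HasDerivWithinAt (fun t => ‖X t - consensus xs‖ ^ 2)
        (2 * inner ℝ (X t - consensus xs) (field J G p H (X t))) (Ici t) t :=
      ((hder t ht).sub_const (consensus xs)).norm_sq
    have h2 : ∀ r : ℝ, HasDerivWithinAt (fun t => Real.exp (r * t)) (Real.exp (r * t) * r)
        (Ici t) t := by
      intro r
      have := ((hasDerivAt_id t).const_mul r).exp.hasDerivWithinAt (s := Ici t)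
      simpa using this
    exact (h2 κ).mul (((h2 (2 * γ)).mul h1).sub_const (A ^ 2))
  · intro t ht
    have h1 := inner_field_le hN hG hF hK hxs hε hα H (X t)
    have h2 := he t (Ico_subset_Icc_self ht)
    set u := ‖X t - consensus xs‖ with hu
    set E := Real.exp (γ * t) with hE
    have hE0 : 0 < E := Real.exp_pos _
    have e1 : Real.exp (2 * γ * t) = E ^ 2 := by
      rw [hE, ← Real.exp_nat_mul]; congr 1; push_cast; ring
    have e2 : Real.exp (-γ * t) = E⁻¹ := by rw [neg_mul, Real.exp_neg]
    rw [e2] at h2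
    rw [e1]
    have hu0 : 0 ≤ u := norm_nonneg _
    have h3 : p.α * K.lamN * u * ‖H - X t‖ ≤ p.α * K.lamN * u * (η * (A * E⁻¹)) := by gcongr
    have h4 : p.α * K.lamN * u * (η * (A * E⁻¹)) = κ * u * A * E⁻¹ := by rw [← hη]; ring
    have h5 : inner ℝ (X t - consensus xs) (field J G p H (X t))
        ≤ -(κ + γ) * u ^ 2 + κ * u * A * E⁻¹ := by
      have : p.ε * nu K p / 2 = κ + γ := by rw [hκ]; ring
      rw [this] at h1
      linarith
    have h6 := mul_le_mul_of_nonneg_left h5 (sq_nonneg E)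
    have h7 : E ^ 2 * (-(κ + γ) * u ^ 2 + κ * u * A * E⁻¹)
        = -(κ + γ) * (E * u) ^ 2 + κ * (E * u) * A := by field_simp
    rw [h7] at h6
    have h8 := mul_nonneg hκ0 (sq_nonneg (E * u - A))
    have h9 : κ * (E ^ 2 * u ^ 2 - A ^ 2) + (E ^ 2 * (2 * γ) * u ^ 2
        + E ^ 2 * (2 * inner ℝ (X t - consensus xs) (field J G p H (X t)))) ≤ 0 := by
      nlinarith
    have h10 := mul_nonneg (Real.exp_pos (κ * t)).le (neg_nonneg.2 h9)
    linarith

end Interval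

/-! ### Induction over the sampling instants -/

section Convergence

variable {N : ℕ} {n : Fin N → ℕ} {J : Fin N → Profile n → ℝ} {G : WGraph N} {μ : ℝ}
  {θown θoth : Fin N → ℝ} {M M' : ℝ} {K : Consts} {p : Params} {xs : Profile n}

theorem scale_eq (K : Consts) (p : Params) (k : ℕ) :
    scale K p k = scale K p 0 * Real.exp (-rate K p * (k * p.T)) := by
  simp only [scale, Nat.cast_zero, mul_zero, zero_mul, Real.exp_zero, mul_one, mul_assoc]

theorem scale_zero (K : Consts) (p : Params) :
    scale K p 0 = p.ε * nu K p * K.M₀ / (p.α * K.lamN) * √(1 - p.β) *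
      Real.exp (-rate K p * p.T - p.α * K.lamN * p.T) := by
  simp [scale]

/-- The requirements on the parameters under which the quantizer never saturates and the
quantization error stays dominated. -/
structure GoodParams (K : Consts) (p : Params) : Prop where
  eps_pos : 0 < p.ε
  T_pos : 0 < p.T
  alpha_pos : 0 < p.α
  nu_pos : 0 < nu K p
  beta_mem : p.β ∈ Ioo (0 : ℝ) 1
  short : p.ε * K.θ * p.T ≤ 1 / 2
  -- Relative error after a sample plus drift over one period, inflated by e^{γT} because the
  -- envelope decays meanwhile, must stay below η'.
  drift : Real.exp (rate K p * p.T) * (p.ε * nu K p / (p.α * K.lamN) * (√(1 - p.β) / 2)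
      + (p.α * K.lamN * (p.ε * nu K p / (p.α * K.lamN) * (√(1 - p.β) / 2) + 1) + p.ε * K.θ)
        / (p.ε * K.θ) * (Real.exp (p.ε * K.θ * p.T) - 1))
      ≤ p.ε * nu K p / (p.α * K.lamN) * (1 / 2 - p.β / 4)
  start_le : K.M₀ / scale K p 0 ≤ p.L
  unsaturated : p.ε * nu K p / (p.α * K.lamN) * (1 / 2 - p.β / 4) * (√((K.N : ℝ) * K.n) * K.M₀)
      ≤ (p.L + 1 / 2) * scale K p 0

theorem expConverges_of_goodParams (hN : 2 ≤ N) (hn : 0 < ∑ i, n i) (hG : G.graph.Connected)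
    (hF : MapAssumption J μ θown θoth) (hM₀ : 0 < M + M')
    (hK : K = consts hN n G μ θown θoth M M') (hxs : gameMap J xs = 0) (hM' : SupBound M' xs)
    (hp : GoodParams K p) : ExpConverges J G K p M xs := by
  have hε := hp.eps_pos
  have hT := hp.T_pos
  have hα := hp.alpha_pos
  have hν := hp.nu_pos
  obtain ⟨hβ0, hβ1⟩ := hp.beta_mem
  have hθ : 0 < K.θ := by rw [hK]; exact lipConst_pos hn hF
  have hlam : 0 < K.lamN := by
    rw [hK]
    refine (WGraph.lam2_pos hN hG).trans_le (sortedEig_mono _ ?_)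
    rw [Fin.le_def]
    change 1 ≤ N - 1
    omega
  have hM0 : 0 < K.M₀ := by rw [hK]; exact hM₀
  set γ := rate K p with hγ
  have hγ0 : 0 < γ := by rw [hγ, rate]; positivity
  -- Initial coordinates differ from those of x* by at most M + M' and a state has Nn coordinates,
  -- so `A` bounds the initial distance; it is also the final constant `C`.
  set A := √((K.N : ℝ) * K.n) * K.M₀ with hA
  have hA0 : 0 ≤ A := by positivity
  set σ := p.ε * nu K p / (p.α * K.lamN) with hσ
  have hσ0 : 0 < σ := by positivity
  set η := σ * (√(1 - p.β) / 2) with hη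
  set η' := σ * (1 / 2 - p.β / 4) with hη'
  have hη0 : 0 ≤ η := by positivity
  have hs : ∀ k, scale K p k = scale K p 0 * Real.exp (-γ * (k * p.T)) := scale_eq K p
  have hs0 : scale K p 0 ≤ σ * K.M₀ * √(1 - p.β) := by
    rw [scale_zero]
    have h1 : Real.exp (-rate K p * p.T - p.α * K.lamN * p.T) ≤ 1 := by
      rw [Real.exp_le_one_iff]
      have : 0 < γ * p.T := by positivity
      have : 0 < p.α * K.lamN * p.T := by positivity
      rw [← hγ]
      linarith
    have h2 : p.ε * nu K p * K.M₀ / (p.α * K.lamN) = σ * K.M₀ := by rw [hσ]; ring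
    rw [h2]
    exact mul_le_of_le_one_right (by positivity) h1
  have hs0pos : 0 < scale K p 0 := by
    rw [scale_zero]
    have : 0 < √(1 - p.β) := Real.sqrt_pos.2 (by linarith)
    positivity
  have hspos : ∀ k, 0 < scale K p k := fun k => by rw [hs]; positivity
  have hNn : √((N : ℝ) * (∑ i, n i : ℕ)) = √((K.N : ℝ) * K.n) := by rw [hK]; rfl
  have hquant : ∀ k, √((K.N : ℝ) * K.n) * (scale K p k / 2)
      ≤ η * (A * Real.exp (-γ * (k * p.T))) := by
    intro k
    rw [hs]
    have h1 : scale K p 0 * (√((K.N : ℝ) * K.n) * Real.exp (-γ * (k * p.T)) / 2)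
        ≤ σ * K.M₀ * √(1 - p.β) * (√((K.N : ℝ) * K.n) * Real.exp (-γ * (k * p.T)) / 2) := by
      gcongr
    rw [hη, hA]
    linarith
  refine ⟨hγ0, A, fun x₀ hx₀ => ⟨?_, ?_⟩⟩
  · refine exists_isTrajectory hF G K hε.le hT ?_ x₀
    have := hp.short
    rw [hK] at this
    exact this
  intro x hx hx0 i t ht
  set X : ℝ → State n := fun t => WithLp.toLp 2 (x t) with hX
  set H : ℕ → State n := fun k => WithLp.toLp 2 fun j => hat K p x j k with hH
  have hstep : ∀ k : ℕ, ‖X (k * p.T) - consensus xs‖ ≤ A * Real.exp (-γ * (k * p.T)) →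
      ‖H k - X (k * p.T)‖ ≤ η * (A * Real.exp (-γ * (k * p.T))) →
      ∀ t ∈ Icc (k * p.T) ((k + 1) * p.T), ‖X t - consensus xs‖ ≤ A * Real.exp (-γ * t) ∧
        ‖H k - X t‖ ≤ η' * (A * Real.exp (-γ * t)) := by
    intro k h1 h2
    have hcont : ContinuousOn X (Icc (k * p.T) ((k + 1) * p.T)) :=
      hx.continuousOn_state.mono fun t ht => le_trans (by positivity) ht.1
    have hder : ∀ t ∈ Ico (k * p.T) ((k + 1) * p.T),
        HasDerivWithinAt X (field J G p (H k) (X t)) (Ici t) t :=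
      fun t ht => hx.hasDerivWithinAt_state k ht
    have herr : ∀ t ∈ Icc (k * p.T) ((k + 1) * p.T),
        ‖H k - X t‖ ≤ η' * (A * Real.exp (-γ * t)) := by
      intro t ht
      have hd := norm_drift_le hN hF hK hxs hθ hε hα.le hcont hder h1 h2 t ht
      have htri := norm_sub_le_norm_sub_add_norm_sub (H k) (X (k * p.T)) (X t)
      rw [norm_sub_rev (X (k * p.T))] at htri
      set R := A * Real.exp (-γ * (k * p.T)) with hR
      have hR0 : 0 ≤ R := by positivity
      set c := (p.α * K.lamN * (η + 1) + p.ε * K.θ) / (p.ε * K.θ) with hc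
      have hc0 : 0 ≤ c := by positivity
      have e1 : (p.α * K.lamN * (η + 1) + p.ε * K.θ) * R / (p.ε * K.θ) = c * R := by
        rw [hc]; ring
      have e2 : Real.exp (p.ε * K.θ * (t - k * p.T)) ≤ Real.exp (p.ε * K.θ * p.T) := by
        gcongr
        linarith [ht.2]
      have e3 : c * R * (Real.exp (p.ε * K.θ * (t - k * p.T)) - 1)
          ≤ c * R * (Real.exp (p.ε * K.θ * p.T) - 1) := by gcongr
      rw [e1] at hd
      have h3 : ‖H k - X t‖ ≤ R * (η + c * (Real.exp (p.ε * K.θ * p.T) - 1)) := by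
        linarith
      have h4 : R ≤ A * Real.exp (-γ * t) * Real.exp (γ * p.T) := by
        rw [hR, mul_assoc A, ← Real.exp_add]
        gcongr
        have := mul_le_mul_of_nonneg_left ht.2 hγ0.le
        linarith
      have hE1 : 1 ≤ Real.exp (p.ε * K.θ * p.T) := Real.one_le_exp (by positivity)
      have h5 : 0 ≤ η + c * (Real.exp (p.ε * K.θ * p.T) - 1) := by
        have := mul_nonneg hc0 (sub_nonneg.2 hE1)
        linarith
      calc ‖H k - X t‖ ≤ R * (η + c * (Real.exp (p.ε * K.θ * p.T) - 1)) := h3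
        _ ≤ A * Real.exp (-γ * t) * Real.exp (γ * p.T)
            * (η + c * (Real.exp (p.ε * K.θ * p.T) - 1)) := by gcongr
        _ = A * Real.exp (-γ * t) * (Real.exp (γ * p.T)
            * (η + c * (Real.exp (p.ε * K.θ * p.T) - 1))) := by ring
        _ ≤ A * Real.exp (-γ * t) * η' := by
            refine mul_le_mul_of_nonneg_left ?_ (by positivity)
            exact hp.drift
        _ = _ := by ring
    have hκ : p.α * K.lamN * η' = p.ε * nu K p / 2 - γ := by
      rw [hη', hσ, hγ, rate]
      field_simp
    have hdec := norm_sub_consensus_le hN hG hF hK hxs hε hα.le hlam.le hA0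
      (κ := p.ε * nu K p / 2 - γ) (by
        rw [← hκ, hη']
        have : 0 < 1 / 2 - p.β / 4 := by linarith
        positivity) rfl hκ hcont hder herr h1
    exact fun t ht => ⟨hdec t ht, herr t ht⟩
  -- The invariant is the state bound and the small error η just after a sample. `hstep` carries
  -- them across the period, where the error may grow to η'; the next message brings it back to η.
  have hind : ∀ k : ℕ, ‖X (k * p.T) - consensus xs‖ ≤ A * Real.exp (-γ * (k * p.T)) ∧
      ‖H k - X (k * p.T)‖ ≤ η * (A * Real.exp (-γ * (k * p.T))) := by
    intro k
    induction k with
    | zero =>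
      have hX0 : X ((0 : ℕ) * p.T) = WithLp.toLp 2 x₀ := by
        simp only [hX, Nat.cast_zero, zero_mul, hx0]
      -- Needed for M ≤ M₀, so that the first message, predicted from 0, does not saturate.
      have hM'0 : 0 ≤ M' := by
        obtain ⟨j, c, -⟩ := exists_coordinate hn
        exact (abs_nonneg _).trans (hM' j c)
      have eM : K.M₀ = M + M' := by rw [hK]; rfl
      constructor
      · rw [hX0]
        have h1 : ‖(WithLp.toLp 2 x₀ : State n) - consensus xs‖
            ≤ √((N : ℝ) * (∑ i, n i : ℕ)) * K.M₀ := by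
          refine norm_le_of_abs_coord_le hM0.le fun i k c => ?_
          rw [eM]
          exact (abs_sub _ _).trans (add_le_add (hx₀ i k c) (hM' k c))
        rw [hNn] at h1
        rwa [Nat.cast_zero, zero_mul, mul_zero, Real.exp_zero, mul_one]
      · refine le_trans ?_ (hquant 0)
        rw [← hNn]
        refine norm_le_of_abs_coord_le (by have := hspos 0; positivity) fun i k c => ?_
        have hL := hp.start_le
        rw [div_le_iff₀ hs0pos] at hL
        have hx₀' : ∀ k (c : Fin (n k)), |x₀ i k c - (0 : Profile n) k c|
            ≤ (p.L + 1 / 2) * scale K p 0 := by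
          intro k c
          have h1 := hx₀ i k c
          simp only [PiLp.zero_apply, sub_zero]
          linarith
        have := abs_decode_sub_le hs0pos hx₀' k c
        rw [hX0]
        rw [zero_add] at this
        have eH : H 0 i = scale K p 0 • (encode p.L (scale K p 0) (x₀ i) 0).toProfile := by
          rw [← hx0]
          change scale K p 0 • (encode p.L (scale K p 0) (x ((0 : ℕ) * p.T) i) 0).toProfile = _
          rw [Nat.cast_zero, zero_mul]
        rw [PiLp.sub_apply, PiLp.sub_apply, PiLp.sub_apply, eH]
        exact this
    | succ k ih =>
      -- The right endpoint belongs to the closed interval, still with the old decoded values: the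
      -- η' bound there controls what the next message must encode, and `unsaturated` keeps it
      -- within range.
      have hmem : ((k + 1 : ℕ) : ℝ) * p.T ∈ Icc (k * p.T) ((k + 1) * p.T) := by
        push_cast
        exact ⟨by nlinarith, le_rfl⟩
      obtain ⟨h1, h2⟩ := hstep k ih.1 ih.2 _ hmem
      refine ⟨h1, le_trans ?_ (hquant (k + 1))⟩
      rw [← hNn]
      have hsk := hspos (k + 1)
      refine norm_le_of_abs_coord_le (by positivity) fun i j c => ?_
      have h3 : η' * (A * Real.exp (-γ * ((k + 1 : ℕ) * p.T)))
          ≤ (p.L + 1 / 2) * scale K p (k + 1) := by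
        rw [hs (k + 1), ← mul_assoc η' A, ← mul_assoc (p.L + 1 / 2 : ℝ)]
        exact mul_le_mul_of_nonneg_right hp.unsaturated (Real.exp_pos _).le
      have h4 : ∀ j (c : Fin (n j)), |x ((k + 1 : ℕ) * p.T) i j c - hat K p x i k j c|
          ≤ (p.L + 1 / 2) * scale K p (k + 1) := by
        intro j c
        rw [abs_sub_comm]
        exact (abs_coord_le_norm (H k - X ((k + 1 : ℕ) * p.T)) i j c).trans (h2.trans h3)
      exact abs_decode_sub_le hsk h4 j c
  have hk1 : (⌊t / p.T⌋₊ : ℝ) * p.T ≤ t := (le_div_iff₀ hT).1 (Nat.floor_le (by positivity))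
  have hk2 : t ≤ (⌊t / p.T⌋₊ + 1) * p.T := ((div_lt_iff₀ hT).1 (Nat.lt_floor_add_one _)).le
  have hfin := (hstep _ (hind ⌊t / p.T⌋₊).1 (hind ⌊t / p.T⌋₊).2 t ⟨hk1, hk2⟩).1
  exact (PiLp.norm_apply_le (X t - consensus xs) i).trans hfin

end Convergence

/-! ### Choice of the parameters -/

section Design

theorem sqrt_one_sub_lt {β : ℝ} (h0 : 0 < β) (h1 : β < 1) : √(1 - β) < 1 - β / 2 := by
  rw [Real.sqrt_lt' (by linarith)]
  nlinarith

theorem exp_sub_one_le_mul_exp (x : ℝ) : Real.exp x - 1 ≤ x * Real.exp x := by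
  have h1 := Real.add_one_le_exp (-x)
  have h2 : Real.exp (-x) * Real.exp x = 1 := by rw [← Real.exp_add]; simp
  nlinarith [Real.exp_pos x]

/-- With `α = c ε`, some number of quantization levels makes the parameters admissible and
satisfies all the requirements of the convergence analysis for every `T`, once `ε` is small. -/
theorem exists_levels {K : Consts} (hN : 0 < K.N) (hμ : 0 < K.μ) (hθ : 0 < K.θ)
    (hlam2 : 0 < K.lam2) (hlamN : 0 < K.lamN) (hM₀ : 0 < K.M₀) {c β a₁ a₂ : ℝ}
    (hc : 1 / K.lam2 * (K.θ ^ 2 / K.μ + K.θ) < c) (hβ : β ∈ Ioo (0 : ℝ) 1)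
    (ha₁ : a₁ ∈ Ioo (0 : ℝ) 1) (ha₂ : a₂ ∈ Ioo (0 : ℝ) (1 - a₁)) :
    ∃ L : ℕ, 0 < L ∧ ∀ T : ℝ, 0 < T → ∃ ε₀ : ℝ, 0 < ε₀ ∧ ∀ ε : ℝ, 0 < ε → ε < ε₀ →
      Admissible K ⟨ε, c * ε, β, a₁, a₂, T, L⟩ ∧ GoodParams K ⟨ε, c * ε, β, a₁, a₂, T, L⟩ := by
  have hc0 : 0 < c := lt_trans (by positivity) hc
  have hβ0 := hβ.1
  have hβ1 := hβ.2
  have ha2 := ha₂.1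
  -- Only α/ε = c matters for ν, so it is computed once at ε = 1.
  obtain ⟨ν, hν⟩ : ∃ ν, ν = nu K ⟨1, c, β, a₁, a₂, 1, 1⟩ := ⟨_, rfl⟩
  have hν0 : 0 < ν := by
    rw [hν]
    exact nu_pos hN hμ hlam2 one_pos hc
  have hnu : ∀ ε T L, 0 < ε → nu K ⟨ε, c * ε, β, a₁, a₂, T, L⟩ = ν := by
    intro ε T L hε
    rw [hν]
    refine nu_congr ?_
    simp only
    field_simp
  set r := √(1 - β) with hr
  have hr0 : 0 < r := Real.sqrt_pos.2 (by linarith)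
  have hr1 : r < 1 - β / 2 := sqrt_one_sub_lt hβ0 hβ1
  set σ := ν / (c * K.lamN) with hσ
  have hσ0 : 0 < σ := by positivity
  set S := √((K.N : ℝ) * K.n) with hS
  have hS0 : 0 ≤ S := Real.sqrt_nonneg _
  -- Small ε makes the exponential `E` in the design rules less than 2. With `E` replaced by 2, the
  -- three bounds cover the initial range M₀/s(0) = E/(σr), nonsaturation at later samples, and the
  -- ceiling condition. None involves `T` or ε.
  obtain ⟨L, hL⟩ := exists_nat_ge (max (max (2 / (σ * r)) (S / r * 2)) (S / a₂))
  have hL1 : 2 / (σ * r) ≤ L := (le_max_left _ _).trans ((le_max_left _ _).trans hL)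
  have hL2 : S / r * 2 ≤ L := (le_max_right _ _).trans ((le_max_left _ _).trans hL)
  have hL3 : S / a₂ ≤ L := (le_max_right _ _).trans hL
  have hLpos : 0 < L := by
    have : (0 : ℝ) < L := lt_of_lt_of_le (by positivity) hL1
    exact_mod_cast this
  refine ⟨L, hLpos, fun T hT => ?_⟩
  have ev1 : ∀ᶠ ε : ℝ in 𝓝 0, ε * K.θ * T < 1 / 2 :=
    (Continuous.tendsto (by fun_prop) 0).eventually_lt_const (by norm_num)
  have ev2 : ∀ᶠ ε : ℝ in 𝓝 0, Real.exp (ε * ν * β / 4 * T + c * ε * K.lamN * T) < 2 :=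
    (Continuous.tendsto (by fun_prop) 0).eventually_lt_const (by norm_num)
  -- At ε = 0 this reads σr/2 < σ(1/2 - β/4), which is r < 1 - β/2.
  have ev3 : ∀ᶠ ε : ℝ in 𝓝 0, Real.exp (ε * ν * β / 4 * T) * (σ * (r / 2)
      + (c * K.lamN * (σ * (r / 2) + 1) + K.θ) / K.θ * (Real.exp (ε * K.θ * T) - 1))
      < σ * (1 / 2 - β / 4) := by
    refine (Continuous.tendsto (by fun_prop) 0).eventually_lt_const ?_
    simp only [zero_mul, zero_div, Real.exp_zero, sub_self, mul_zero, add_zero, one_mul]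
    gcongr
    linarith
  -- In (a1), e^{γT} - 1 ≤ γTe^{γT} and γ is proportional to ε, which absorbs ε⁻¹; the factor
  -- e^{αλ_N T} - 1 still tends to 0.
  have ev4 : ∀ᶠ ε : ℝ in 𝓝 0, (Real.exp (c * ε * K.lamN * T) - 1)
      * (ν * β / 4 * T * Real.exp (ε * ν * β / 4 * T))
      * ((K.θ / (c * K.lamN) + 1) * (8 * c * K.lamN / (ν ^ 2 * β * r))) < a₁ := by
    refine (Continuous.tendsto (by fun_prop) 0).eventually_lt_const ?_
    simpa using ha₁.1
  obtain ⟨ε₀, hε₀, hall⟩ := Metric.eventually_nhds_iff.1 (ev1.and (ev2.and (ev3.and ev4)))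
  refine ⟨ε₀, hε₀, fun ε hε hlt => ?_⟩
  obtain ⟨h1, h2, h3, h4⟩ := hall (y := ε) (by rwa [dist_zero_right, Real.norm_of_nonneg hε.le])
  have hnu' := hnu ε T L hε
  set p : Params := ⟨ε, c * ε, β, a₁, a₂, T, L⟩ with hp
  have hrate : rate K p = ε * ν * β / 4 := by rw [rate, hnu']
  have hσp : p.ε * nu K p / (p.α * K.lamN) = σ := by
    rw [hnu', hσ]
    simp only [hp]
    field_simp
  set E := Real.exp (ε * ν * β / 4 * T + c * ε * K.lamN * T) with hE
  have hE0 : 0 < E := Real.exp_pos _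
  have hscale : scale K p 0 = σ * K.M₀ * r / E := by
    have e1 : Real.exp (-rate K p * p.T - p.α * K.lamN * p.T) = E⁻¹ := by
      rw [hE, ← Real.exp_neg, hrate]
      congr 1
      ring
    have e2 : p.ε * nu K p * K.M₀ / (p.α * K.lamN) = σ * K.M₀ := by rw [← hσp]; ring
    rw [scale_zero, e1, e2]
    rfl
  have hstart : K.M₀ / scale K p 0 ≤ p.L := by
    have e : K.M₀ / scale K p 0 = E / (σ * r) := by rw [hscale]; field_simp
    rw [e]
    refine le_trans ?_ hL1
    gcongr
  constructor
  · refine ⟨hε, hT, ?_, hβ, ha₁, ha₂, ?_, hLpos, hstart, ?_⟩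
    · have := mul_lt_mul_of_pos_right hc hε
      calc ε / K.lam2 * (K.θ ^ 2 / K.μ + K.θ)
          = 1 / K.lam2 * (K.θ ^ 2 / K.μ + K.θ) * ε := by ring
        _ < c * ε := this
    · have hrho : rho K p = (K.θ / (c * K.lamN) + 1) * (8 * c * K.lamN / (ν ^ 2 * β * r)) := by
        rw [rho, hnu']
        simp only [hp]
        rw [← hr]
        field_simp
      rw [SamplingCondition, hrho, hrate]
      refine le_trans ?_ h4.le
      have hx := exp_sub_one_le_mul_exp (ε * ν * β / 4 * T)
      have hx2 : (Real.exp (ε * ν * β / 4 * T) - 1) * ε⁻¹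
          ≤ ν * β / 4 * T * Real.exp (ε * ν * β / 4 * T) := by
        rw [mul_inv_le_iff₀ hε]
        linarith
      have hx3 : 0 ≤ Real.exp (c * ε * K.lamN * T) - 1 :=
        sub_nonneg.2 (Real.one_le_exp (by positivity))
      have hρ0 : 0 ≤ (K.θ / (c * K.lamN) + 1) * (8 * c * K.lamN / (ν ^ 2 * β * r)) := by
        positivity
      calc _ = (Real.exp (c * ε * K.lamN * T) - 1) * ((Real.exp (ε * ν * β / 4 * T) - 1) * ε⁻¹)
          * ((K.θ / (c * K.lamN) + 1) * (8 * c * K.lamN / (ν ^ 2 * β * r))) := by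
            simp only [hp]; ring
        _ ≤ _ := by gcongr
    · rw [Int.ceil_le, hnu']
      have e : p.ε * ν * p.β * p.T / 4 + p.α * K.lamN * p.T
          = ε * ν * β / 4 * T + c * ε * K.lamN * T := by simp only [hp]; ring
      rw [e, ← hE, ← hS]
      have h5 : S * E / (2 * a₂) ≤ S * 2 / (2 * a₂) := by gcongr
      have h6 : S * 2 / (2 * a₂) = S / a₂ := by field_simp
      rw [h6] at h5
      change S * E / (2 * a₂) - 1 / 2 ≤ ((L : ℤ) : ℝ)
      push_cast
      linarith
  · refine ⟨hε, hT, mul_pos hc0 hε, by rwa [hnu'], hβ, h1.le, ?_, hstart, ?_⟩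
    -- Since α = cε, ε cancels from the quotient in the drift coefficient and survives only in the
    -- exponentials.
    · rw [hσp, hrate]
      refine le_trans (le_of_eq ?_) h3.le
      simp only [hp]
      rw [← hr]
      congr 3
      field_simp
    · rw [hσp, hscale, mul_div_assoc', le_div_iff₀ hE0, ← hS]
      simp only [hp]
      have h5 : S * 2 ≤ L * r := by
        have := mul_le_mul_of_nonneg_right hL2 hr0.le
        calc S * 2 = S / r * 2 * r := by field_simp
          _ ≤ _ := this
      have h6 : (1 / 2 - β / 4) * S * E ≤ 1 * S * 2 := by gcongr; linarith
      have h7 : (1 / 2 - β / 4) * S * E ≤ (L + 1 / 2) * r := by linarith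
      have h8 := mul_le_mul_of_nonneg_left h7 (mul_pos hσ0 hM₀).le
      linarith

end Design

end QNash

/-! ### Assembly of the theorem -/

theorem theorem2 {N : ℕ} (hN : 2 ≤ N) (n : Fin N → ℕ) (hn : 0 < ∑ i, n i)
    (J : Fin N → QNash.Profile n → ℝ) (G : QNash.WGraph N) (hG : G.graph.Connected)
    (μ : ℝ) (θown θoth : Fin N → ℝ)
    (hJ : QNash.CostAssumption J) (hF : QNash.MapAssumption J μ θown θoth)
    (M M' : ℝ) (hM₀ : 0 < M + M')
    (hM' : ∀ x, QNash.IsNash J x → QNash.SupBound M' x)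
    (K : QNash.Consts) (hK : K = QNash.consts hN n G μ θown θoth M M') :
    ∃ xs : QNash.Profile n, QNash.IsNash J xs ∧ (∀ y, QNash.IsNash J y → y = xs) ∧
      -- every positive bandwidth is attained by an exponentially convergent design
      (∀ B : ℝ, 0 < B → ∃ p : QNash.Params, QNash.Admissible K p ∧
        QNash.algBandwidth G K p = (B : EReal) ∧ QNash.ExpConverges J G K p M xs) ∧
      -- with `α = c ε`, one number `L` of levels serves every `T`, once `ε` is small
      (∀ c β a₁ a₂ : ℝ, 1 / K.lam2 * (K.θ ^ 2 / K.μ + K.θ) < c →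
        β ∈ Set.Ioo (0 : ℝ) 1 → a₁ ∈ Set.Ioo (0 : ℝ) 1 → a₂ ∈ Set.Ioo (0 : ℝ) (1 - a₁) →
        ∃ L : ℕ, ∀ T : ℝ, 0 < T → ∃ ε₀ : ℝ, 0 < ε₀ ∧ ∀ ε : ℝ, 0 < ε → ε < ε₀ →
          ∀ p : QNash.Params, p = ⟨ε, c * ε, β, a₁, a₂, T, L⟩ →
            QNash.Admissible K p ∧
            QNash.algBandwidth G K p = ((QNash.bitsPerSample K L / T : ℝ) : EReal) ∧
            QNash.ExpConverges J G K p M xs) := by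
  obtain ⟨xs, hxs⟩ := QNash.exists_gameMap_eq_zero hn hF
  have hNash := (QNash.isNash_iff_gameMap_eq_zero hJ xs).2 hxs
  have hlam2 : 0 < K.lam2 := by rw [hK]; exact QNash.WGraph.lam2_pos hN hG
  have hlamN : 0 < K.lamN := by
    refine hlam2.trans_le ?_
    rw [hK]
    refine QNash.sortedEig_mono G.lap_isHermitian ?_
    rw [Fin.le_def]
    change 1 ≤ N - 1
    omega
  have hKN : 0 < K.N := by rw [hK]; change 0 < N; omega
  have hKn : 0 < K.n := by rw [hK]; exact hn
  have hKμ : 0 < K.μ := by rw [hK]; exact hF.mu_pos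
  have hKθ : 0 < K.θ := by rw [hK]; exact QNash.lipConst_pos hn hF
  have hKM : 0 < K.M₀ := by rw [hK]; exact hM₀
  have hconv : ∀ p, QNash.GoodParams K p → QNash.ExpConverges J G K p M xs := fun p hp =>
    QNash.expConverges_of_goodParams hN hn hG hF hM₀ hK hxs (hM' xs hNash) hp
  refine ⟨xs, hNash, fun y hy => QNash.eq_of_gameMap_eq_zero hF
    ((QNash.isNash_iff_gameMap_eq_zero hJ y).1 hy) hxs, fun B hB => ?_, ?_⟩
  -- Any admissible c, β, a₁, a₂ would do here.
  · obtain ⟨L, hL, h⟩ := QNash.exists_levels hKN hKμ hKθ hlam2 hlamN hKM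
      (lt_add_one (1 / K.lam2 * (K.θ ^ 2 / K.μ + K.θ))) (β := 1 / 2) (a₁ := 1 / 2) (a₂ := 1 / 4)
      (by norm_num) (by norm_num) (by norm_num)
    have hbits : 0 < QNash.bitsPerSample K L := by
      refine mul_pos (by exact_mod_cast hKn) (Real.logb_pos one_lt_two ?_)
      have : (0 : ℝ) < L := by exact_mod_cast hL
      linarith
    -- `L` is already fixed, so this period makes bits per second equal to `B` exactly.
    obtain ⟨ε₀, hε₀, h⟩ := h (QNash.bitsPerSample K L / B) (by positivity)
    obtain ⟨hadm, hgood⟩ := h (ε₀ / 2) (by positivity) (by linarith)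
    refine ⟨_, hadm, ?_, hconv _ hgood⟩
    rw [QNash.algBandwidth_eq hN hG K _ hadm.T_pos]
    congr 1
    change QNash.bitsPerSample K L / (QNash.bitsPerSample K L / B) = B
    field_simp
  · intro c β a₁ a₂ hc hβ ha₁ ha₂
    obtain ⟨L, -, h⟩ := QNash.exists_levels hKN hKμ hKθ hlam2 hlamN hKM hc hβ ha₁ ha₂
    refine ⟨L, fun T hT => ?_⟩
    obtain ⟨ε₀, hε₀, h⟩ := h T hT
    refine ⟨ε₀, hε₀, fun ε hε hlt p hp => ?_⟩
    obtain ⟨hadm, hgood⟩ := h ε hε hlt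
    subst hp
    exact ⟨hadm, QNash.algBandwidth_eq hN hG K _ hT, hconv _ hgood⟩
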